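/- Let $(X_0,\|\cdot\|)$ be a complex Banach space and let $\tau$ be a topology on $X_0$ such that: (1) $\tau$ is a Hausdorff locally convex vector space topology that is coarser than the norm topology; (2) $\tau$ is sequentially complete on the closed unit ball, i.e., every $\tau$-Cauchy sequence in the closed unit ball is $\tau$-convergent to an element of the closed unit ball; (3) $\|x\|=\sup\{|\varphi(x)|:\varphi\in(X_0,\tau)',\ \|\varphi\|\le 1\}$ for every $x\in X_0$. A family $(S_i)_{i\in I}$ of bounded operators on $X_0$ is called *bi-equicontinuous* if for every norm-bounded sequence $(x_n)$ that $\tau$-converges to $0$ one has $S_ix_n\to 0$ in $\tau$ as $n\to\infty$, uniformly in $i\in I$. A *bi-continuous semigroup* is a family $(T(t))_{t\ge0}$ of bounded linear operators on $X_0$ with $T(0)=I$ and $T(t+s)=T(t)T(s)$ such that $t\mapsto T(t)x$ is $\tau$-continuous on $[0,\infty)$ for each $x\in X_0$, the family is exponentially bounded, and $(T(s))_{s\in[0,t_0]}$ is bi-equicontinuous for each $t_0\ge0$. It is of *type* $(M,\omega)$ if $\|T(t)\|\le Me^{\omega t}$ for all $t\ge 0$. Its *generator* is the operator $Ax:=\tau\text{-}\lim_{t\downarrow0}\frac{T(t)x-x}{t}$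 with domain $$D(A)=\Bigl\{x\in X_0:\ \tau\text{-}\lim_{t\downarrow0}\tfrac{T(t)x-x}{t}\text{ exists and }\sup_{t\in(0,1]}\tfrac{\|T(t)x-x\|}{t}<\infty\Bigr\}.$$ **Theorem (Kühnemund).** Let $A:D(A)\subseteq X_0\to X_0$ be a linear operator, let $M\ge1$ and $\omega\in\mathbb R$. The following are equivalent: (i) $A$ is the generator of a bi-continuous semigroup $(T(t))_{t\ge0}$ of type $(M,\omega)$. (ii) $A$ is a Hille–Yosida operator of type $(M,\omega)$, i.e., every $s>\omega$ belongs to the resolvent set of $A$ and the resolvent $R(s,A)=(s-A)^{-1}$ satisfies $$\|R(s,A)^k\|\le\frac{M}{(s-\omega)^k}\qquad\text{for all }k\in\mathbb N\text{ and all }s>\omega;$$ moreover, $A$ is bi-densely defined, i.e., each $x\in X_0$ is the $\tau$-limit of a norm-bounded sequence in $D(A)$; and for each $\alpha>\omega$ the family $\{(s-\alpha)^kR(s,A)^k:\ k\in\mathbb N,\ s\ge\alpha\}$ is bi-equicontinuous. In this case, for the semigroup $(T(t))_{t\ge0}$ generated by $A$, the Euler formula $$T(t)x=\tau\text{-}\lim_{m\to\infty}\Bigl(\frac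 mt R\bigl(\tfrac mt,A\bigr)\Bigr)^mx$$ holds for each $x\in X_0$ and $t>0$. Moreover, the norm closure $\underline X_0:=\overline{D(A)}$ is the space of norm strong continuity of the semigroup, i.e., $\underline X_0=\{x\in X_0: t\mapsto T(t)x\text{ is norm-continuous on }[0,\infty)\}$; it is invariant under every $T(t)$; and $(T(t)|_{\underline X_0})_{t\ge0}$ is a (norm) strongly continuous semigroup on $\underline X_0$ whose generator is the part of $A$ in $\underline X_0$, i.e., the restriction of $A$ to $\{x\in D(A): Ax\in\underline X_0\}$. -/

import Mathlib

open Filter Topology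
open scoped NNReal

noncomputable section

namespace BiCont

/-- The norm topology of a normed space, as an explicit term. -/
abbrev normTopology (E : Type*) [NormedAddCommGroup E] : TopologicalSpace E := inferInstance

/-- A second topology `τ` on a normed space `E` such that `(E, ‖·‖, τ)` satisfies the bi-continuity
assumptions. This is a plain structure (not a class), so that the instance topology of `E` is always
the norm topology, and `τ` is only used where it is mentioned. -/
structure CoarseTopology (E : Type*) [NormedAddCommGroup E] [NormedSpace ℂ E] where
  /-- the topology `τ` -/
  top : TopologicalSpace E
  /-- `τ` is a vector space topology ... -/
  isTopologicalAddGroup : @IsTopologicalAddGroup E top _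
  continuousSMul : @ContinuousSMul ℂ E _ _ top
  /-- ... which is locally convex ... -/
  locallyConvex : @LocallyConvexSpace ℝ E _ _ _ _ top
  /-- ... and Hausdorff. -/
  hausdorff : @T2Space E top
  /-- `τ` is coarser than the norm topology. -/
  coarser : @Continuous E E (normTopology E) top id
  /-- `τ` is sequentially complete on the closed unit ball: every `τ`-Cauchy sequence in the closed
  unit ball is `τ`-convergent to an element of the closed unit ball. -/
  seqComplete : ∀ u : ℕ → E, (∀ n, ‖u n‖ ≤ 1) →
    (∀ U ∈ @nhds E top 0, ∃ N, ∀ m ≥ N, ∀ n ≥ N, u m - u n ∈ U) →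
    ∃ x : E, ‖x‖ ≤ 1 ∧ Tendsto u atTop (@nhds E top x)
  /-- The dual of `(E, τ)` is norming: `‖x‖` is the supremum of `|φ x|` over all `τ`-continuous
  linear functionals `φ` of norm at most one. -/
  norming : ∀ x : E, IsLUB
    {r : ℝ | ∃ φ : E →ₗ[ℂ] ℂ, @Continuous E ℂ top _ φ ∧ (∀ y, ‖φ y‖ ≤ ‖y‖) ∧ r = ‖φ x‖} ‖x‖

variable {E : Type*} [NormedAddCommGroup E] [NormedSpace ℂ E]

/-- The neighbourhood filter of a point for the topology `τ`. -/
def CoarseTopology.nhds (τ : CoarseTopology E) (x : E) : Filter E := @_root_.nhds E τ.top x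

/-- A family `S` of maps is bi-equicontinuous: for every norm-bounded sequence `u` which `τ`-converges
to `0`, one has `S i (u n) → 0` in `τ` as `n → ∞`, uniformly in the index `i`. -/
def BiEquicontinuous (τ : CoarseTopology E) {ι : Type*} (S : ι → E →L[ℂ] E) : Prop :=
  ∀ u : ℕ → E, (∃ C : ℝ, ∀ n, ‖u n‖ ≤ C) → Tendsto u atTop (τ.nhds 0) →
    ∀ U ∈ τ.nhds 0, ∀ᶠ n in atTop, ∀ i, S i (u n) ∈ U

/-! ### Semigroups and generators -/

/-- The family `T` is of type `(M, ω)`: `‖T(t)‖ ≤ M e^{ω t}` for all `t ≥ 0`. -/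
def HasType (T : ℝ≥0 → E →L[ℂ] E) (M ω : ℝ) : Prop :=
  ∀ t : ℝ≥0, ‖T t‖ ≤ M * Real.exp (ω * t)

/-- `T` is a bi-continuous semigroup on `(E, ‖·‖, τ)`. -/
structure IsBiContinuousSemigroup (τ : CoarseTopology E) (T : ℝ≥0 → E →L[ℂ] E) : Prop where
  map_zero : T 0 = ContinuousLinearMap.id ℂ E
  map_add : ∀ s t : ℝ≥0, T (t + s) = (T t).comp (T s)
  /-- strong `τ`-continuity -/
  strongly_continuous : ∀ x : E, @Continuous ℝ≥0 E _ τ.top (fun t => T t x)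
  exponentially_bounded : ∃ M ω : ℝ, 1 ≤ M ∧ HasType T M ω
  locally_biequicontinuous : ∀ t₀ : ℝ≥0, BiEquicontinuous τ (fun s : Set.Iic t₀ => T s)

/-- `A` is the generator of the bi-continuous semigroup `T`: `x ∈ D(A)` and `A x = y` if and only if
`(T(t)x - x)/t` is norm-bounded for `t ∈ (0,1]` and `τ`-converges to `y` as `t → 0+`. -/
def IsBiGenerator (τ : CoarseTopology E) (T : ℝ≥0 → E →L[ℂ] E) (A : E →ₗ.[ℂ] E) : Prop :=
  ∀ x y : E, (x, y) ∈ A.graph ↔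
    Tendsto (fun t : ℝ≥0 => (t : ℝ)⁻¹ • (T t x - x)) (𝓝[>] 0) (τ.nhds y) ∧
    ∃ C : ℝ, ∀ t : ℝ≥0, 0 < t → t ≤ 1 → ‖(t : ℝ)⁻¹ • (T t x - x)‖ ≤ C

/-- `T` is a (norm) strongly continuous semigroup, i.e. a `C₀`-semigroup. -/
structure IsC0Semigroup (T : ℝ≥0 → E →L[ℂ] E) : Prop where
  map_zero : T 0 = ContinuousLinearMap.id ℂ E
  map_add : ∀ s t : ℝ≥0, T (t + s) = (T t).comp (T s)
  strongly_continuous : ∀ x : E, Continuous (fun t => T t x)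

/-- `A` is the generator of the `C₀`-semigroup `T`: `x ∈ D(A)` and `A x = y` if and only if
`(T(t)x - x)/t → y` in norm as `t → 0+`. -/
def IsC0Generator (T : ℝ≥0 → E →L[ℂ] E) (A : E →ₗ.[ℂ] E) : Prop :=
  ∀ x y : E, (x, y) ∈ A.graph ↔
    Tendsto (fun t : ℝ≥0 => (t : ℝ)⁻¹ • (T t x - x)) (𝓝[>] 0) (𝓝 y)

/-! ### Resolvents of unbounded operators -/

/-- The bounded operator `R` is a two-sided inverse of `z - A : D(A) → E`. -/
def IsResolventAt (A : E →ₗ.[ℂ] E) (z : ℂ) (R : E →L[ℂ] E) : Prop :=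
  (∀ x : E, ∃ h : R x ∈ A.domain, z • R x - A ⟨R x, h⟩ = x) ∧
  ∀ x : A.domain, R (z • (x : E) - A x) = x

theorem IsResolventAt.unique {A : E →ₗ.[ℂ] E} {z : ℂ} {R S : E →L[ℂ] E}
    (hR : IsResolventAt A z R) (hS : IsResolventAt A z S) : R = S := by
  ext x
  obtain ⟨h, hx⟩ := hS.1 x
  have := hR.2 ⟨S x, h⟩
  rw [hx] at this
  exact this

/-- The resolvent set `ρ(A)`. -/
def resolventSet (A : E →ₗ.[ℂ] E) : Set ℂ := {z | ∃ R : E →L[ℂ] E, IsResolventAt A z R}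

open Classical in
/-- The resolvent `R(z, A) = (z - A)⁻¹` for `z ∈ ρ(A)` (and `0` for other `z`). -/
def resolvent (A : E →ₗ.[ℂ] E) (z : ℂ) : E →L[ℂ] E :=
  if h : z ∈ resolventSet A then h.choose else 0

theorem isResolventAt_resolvent {A : E →ₗ.[ℂ] E} {z : ℂ} (h : z ∈ resolventSet A) :
    IsResolventAt A z (resolvent A z) := by
  rw [resolvent, dif_pos h]
  exact h.choose_spec

/-- `A` is a Hille–Yosida operator of type `(M, ω)`: `(ω, ∞) ⊆ ρ(A)` and
`‖R(s, A)^k‖ ≤ M / (s - ω)^k` for all `s > ω` and all `k`. -/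
def IsHilleYosida (A : E →ₗ.[ℂ] E) (M ω : ℝ) : Prop :=
  ∀ s : ℝ, ω < s → (s : ℂ) ∈ resolventSet A ∧
    ∀ k : ℕ, ‖resolvent A (s : ℂ) ^ k‖ ≤ M / (s - ω) ^ k

/-- `A` is bi-densely defined: every `x` is the `τ`-limit of a norm-bounded sequence in `D(A)`. -/
def IsBiDenselyDefined (τ : CoarseTopology E) (A : E →ₗ.[ℂ] E) : Prop :=
  ∀ x : E, ∃ u : ℕ → E, (∀ n, u n ∈ A.domain) ∧ (∃ C : ℝ, ∀ n, ‖u n‖ ≤ C) ∧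
    Tendsto u atTop (τ.nhds x)

/-! ### Parts and restrictions -/

/-- The part of `A` in the subspace `Y`: its domain is `{x ∈ D(A) ∩ Y : A x ∈ Y}`, where it acts
as `A`. -/
def part (A : E →ₗ.[ℂ] E) (Y : Submodule ℂ E) : Y →ₗ.[ℂ] Y :=
  (A.graph.comap (Y.subtype.prodMap Y.subtype)).toLinearPMap

theorem mem_graph_part {A : E →ₗ.[ℂ] E} {Y : Submodule ℂ E} {x y : Y} :
    (x, y) ∈ (part A Y).graph ↔ ((x : E), (y : E)) ∈ A.graph := by
  rw [part, Submodule.toLinearPMap_graph_eq]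
  · rfl
  · rintro ⟨a, b⟩ hab ha
    simp only at ha
    subst ha
    have h : (((0 : Y) : E), (b : E)) ∈ A.graph := hab
    exact Subtype.ext (LinearPMap.graph_fst_eq_zero_snd A h rfl)

/-- The domain `D(A)`, closed up in norm. -/
def domainClosure (A : E →ₗ.[ℂ] E) : Submodule ℂ E := A.domain.topologicalClosure

end BiCont

end

/-! Two devices carry the proof. The first is a weak integral. Orbits are only τ-continuous, so they
need not be Bochner integrable. `exists_weakIntegral` integrates step approximations and passes to
the limit by sequential completeness on balls; identities and estimates are then read off through
τ-continuous functionals, which separate points and are norming. With it the generator becomes the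
integrated relation T(t)x - x = ∫₀ᵗ T(r)y dr (`genRel_iff_intRel`), which is stable under bounded
τ-limits.

Necessity. The resolvent is the Laplace transform of T (`IsLaplace.intRel`,
`IsLaplace.apply_of_intRel`). A seminorm bound p(T(r)x) ≤ c e^{αr} along the whole orbit passes to
Qx with c replaced by c/(s-α) (`IsLaplace.seminorm_le`). Iteration bounds all powers: p = |φ| gives
the Hille–Yosida estimates, a general p gives bi-equicontinuity. Short time averages of orbits give
bi-density.

Sufficiency. The second device is the implicit Euler step J_h = (1 - hA)⁻¹. On D(A²) it satisfies
J_h x = x + hAx + O(h²) in norm. A telescoping sum (`norm_pow_sub_pow_le`) turns one-step errors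
O((t/n)²) into an O(1/n) error after n steps, so J_{t/n}ⁿx is norm Cauchy. Since D(A²) is bi-dense
and the powers are bi-equicontinuous, the limit T(t)x exists in τ for every x. The same telescoping,
for J_a J_b against J_{a+b}, gives the semigroup law. The generator of T extends A, and the two
agree because s - A is onto while s minus the generator is injective for some s.

Comparing T(t/n)ⁿ with J_{t/n}ⁿ in the same way proves the Euler formula for any T generated by A.
The norm statements follow from the integrated relation: orbits from D(A) are Lipschitz near 0, and
time averages of norm-continuous orbits converge in norm. -/

noncomputable section

namespace BiCont

variable {E : Type*} [NormedAddCommGroup E] [NormedSpace ℂ E]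

/-! ### The topology `τ` through its continuous seminorms and functionals -/

section LocallyConvex

open scoped ComplexOrder

/-- The nonnegative elements of ℂ are exactly the nonnegative reals, so real and complex convexity
of a set agree. Complex local convexity is what yields a description by complex seminorms. -/
theorem locallyConvexSpace_complex_of_real (F : Type*) [AddCommGroup F] [Module ℂ F] [Module ℝ F]
    [IsScalarTower ℝ ℂ F] [TopologicalSpace F] [h : LocallyConvexSpace ℝ F] :
    LocallyConvexSpace ℂ F := by
  refine ⟨fun x => (h.convex_basis x).congr (fun s => ?_) (fun _ _ => rfl)⟩
  refine and_congr_right fun _ => ⟨fun hs => ?_, fun hs => hs.lift ℝ⟩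
  exact convex_of_nonneg_surjective_algebraMap _
    (fun _ => (RCLike.nonneg_iff_exists_ofReal (K := ℂ)).mp) hs

theorem polynormableSpace_of_locallyConvex_real (F : Type*) [AddCommGroup F] [Module ℂ F]
    [Module ℝ F] [IsScalarTower ℝ ℂ F] [TopologicalSpace F] [IsTopologicalAddGroup F]
    [ContinuousSMul ℂ F] [h : LocallyConvexSpace ℝ F] : PolynormableSpace ℂ F := by
  have : LocallyConvexSpace ℂ F := locallyConvexSpace_complex_of_real F
  have : ContinuousSMul ℝ F := IsScalarTower.continuousSMul (M := ℝ) ℂ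
  infer_instance

theorem tendsto_nhds_iff_forall_seminorm {F : Type*} [AddCommGroup F] [Module ℂ F]
    [TopologicalSpace F] [PolynormableSpace ℂ F] {ι : Type*} {u : ι → F} {l : Filter ι} {x : F} :
    Tendsto u l (𝓝 x) ↔
      ∀ p : Seminorm ℂ F, Continuous p → Tendsto (fun i => p (u i - x)) l (𝓝 0) := by
  rw [(PolynormableSpace.withSeminorms ℂ F).tendsto_nhds]
  constructor
  · intro H p hp
    rw [Metric.tendsto_nhds]
    intro ε hε
    filter_upwards [H ⟨p, hp⟩ ε hε] with i hi
    simpa [abs_of_nonneg (apply_nonneg p _)] using hi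
  · intro H p ε hε
    filter_upwards [(H p.1 p.2).eventually_lt_const hε] with i hi using hi

theorem exists_continuous_seminorm_of_mem_nhds_zero {F : Type*} [AddCommGroup F] [Module ℂ F]
    [TopologicalSpace F] [PolynormableSpace ℂ F] {U : Set F} (hU : U ∈ 𝓝 (0 : F)) :
    ∃ p : Seminorm ℂ F, Continuous p ∧ ∃ ε > 0, ∀ x, p x < ε → x ∈ U := by
  have hw := PolynormableSpace.withSeminorms ℂ F
  have := hw.topologicalAddGroup
  obtain ⟨s, r, hr, hs⟩ := (hw.mem_nhds_iff 0 U).1 hU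
  exact ⟨s.sup fun p : {p : Seminorm ℂ F // Continuous p} => p.1,
    Seminorm.continuous_finsetSup fun i _ => i.2, r, hr,
    fun x hx => hs (by simpa [Seminorm.mem_ball] using hx)⟩

theorem continuous_of_norm_le_seminorm {F : Type*} [AddCommGroup F] [Module ℂ F]
    [TopologicalSpace F] [PolynormableSpace ℂ F] {g : F →ₗ[ℂ] ℂ} {p : Seminorm ℂ F}
    (hp : Continuous p) (hg : ∀ x, ‖g x‖ ≤ p x) : Continuous g :=
  (PolynormableSpace.withSeminorms ℂ F).continuous_normedSpace_rng ℂ g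
    ⟨{⟨p, hp⟩}, 1, fun x => by simpa using hg x⟩

end LocallyConvex

/-! ### Convergence, functionals and completeness for τ. -/

namespace CoarseTopology

variable (τ : CoarseTopology E)

theorem polynormableSpace : @PolynormableSpace ℂ E _ _ _ τ.top :=
  @polynormableSpace_of_locallyConvex_real E _ _ _ _ τ.top τ.isTopologicalAddGroup
    τ.continuousSMul τ.locallyConvex

/-- The seminorm `p` is `τ`-continuous. -/
def IsSeminorm (p : Seminorm ℂ E) : Prop := @Continuous E ℝ τ.top _ p

/-- The functional `φ` is `τ`-continuous. -/
def IsFunctional (φ : E →L[ℂ] ℂ) : Prop := @Continuous E ℂ τ.top _ φ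

variable {τ}

theorem tendsto_iff {ι : Type*} {u : ι → E} {l : Filter ι} {x : E} :
    Tendsto u l (τ.nhds x) ↔
      ∀ p, τ.IsSeminorm p → Tendsto (fun i => p (u i - x)) l (𝓝 0) := by
  exact @tendsto_nhds_iff_forall_seminorm E _ _ τ.top τ.polynormableSpace _ _ _ _

theorem tendsto_zero_iff {ι : Type*} {u : ι → E} {l : Filter ι} :
    Tendsto u l (τ.nhds 0) ↔ ∀ p, τ.IsSeminorm p → Tendsto (fun i => p (u i)) l (𝓝 0) := by
  simp [tendsto_iff]

theorem tendsto_sub_iff {ι : Type*} {u : ι → E} {l : Filter ι} {x : E} :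
    Tendsto (fun i => u i - x) l (τ.nhds 0) ↔ Tendsto u l (τ.nhds x) := by
  rw [tendsto_zero_iff, tendsto_iff]

theorem IsSeminorm.mem_nhds {p : Seminorm ℂ E} (hp : τ.IsSeminorm p) {ε : ℝ} (hε : 0 < ε) :
    {x | p x < ε} ∈ τ.nhds 0 := by
  have h : Tendsto p (τ.nhds 0) (𝓝 (p 0)) := (@Continuous.tendsto E ℝ τ.top _ p hp 0)
  rw [map_zero] at h
  exact h.eventually_lt_const hε

theorem exists_seminorm_of_mem_nhds {U : Set E} (hU : U ∈ τ.nhds 0) :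
    ∃ p, τ.IsSeminorm p ∧ ∃ ε > 0, ∀ x, p x < ε → x ∈ U := by
  exact @exists_continuous_seminorm_of_mem_nhds_zero E _ _ τ.top τ.polynormableSpace _ hU

theorem IsSeminorm.continuous {p : Seminorm ℂ E} (hp : τ.IsSeminorm p) : Continuous p := by
  have h := @Continuous.comp E E ℝ (normTopology E) τ.top _ id p hp τ.coarser
  exact h

theorem IsSeminorm.exists_bound {p : Seminorm ℂ E} (hp : τ.IsSeminorm p) :
    ∃ C, 0 < C ∧ ∀ x, p x ≤ C * ‖x‖ :=
  Seminorm.bound_of_continuous_normedSpace p hp.continuous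

/-- Hahn–Banach, applied to c • x ↦ c p(x) on the line through x. It reduces a seminorm bound for a
weakly defined vector to a bound for one scalar integral. -/
theorem exists_functional {p : Seminorm ℂ E} (hp : τ.IsSeminorm p) (x : E) :
    ∃ φ, τ.IsFunctional φ ∧ (∀ y, ‖φ y‖ ≤ p y) ∧ ‖φ x‖ = p x := by
  rcases eq_or_ne x 0 with rfl | hx
  · refine ⟨0, @continuous_const E ℂ τ.top _ 0, fun y => by simp, by simp⟩
  let f : Module.Dual ℂ (ℂ ∙ x) :=
    (p x : ℂ) • (LinearEquiv.toSpanNonzeroSingleton ℂ E x hx).symm.toLinearMap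
  have hf (c : ℂ) (h : c • x ∈ ℂ ∙ x) : f ⟨c • x, h⟩ = p x * c := by
    have : (⟨c • x, h⟩ : ℂ ∙ x) = LinearEquiv.toSpanNonzeroSingleton ℂ E x hx c := rfl
    simp only [f, this, LinearMap.smul_apply, LinearEquiv.coe_coe,
      LinearEquiv.symm_apply_apply, smul_eq_mul]
  obtain ⟨g, hg, hgp⟩ := Module.Dual.exists_extension_of_le_seminorm (ℂ ∙ x) f (p := p) (by
    rintro ⟨y, hy⟩
    obtain ⟨c, rfl⟩ := Submodule.mem_span_singleton.1 hy
    rw [hf, norm_mul, Complex.norm_real, Real.norm_of_nonneg (apply_nonneg p x)]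
    simp [map_smul_eq_mul, mul_comm])
  obtain ⟨C, -, hC⟩ := hp.exists_bound
  refine ⟨g.mkContinuous C fun y => (hgp y).trans (hC y), ?_, hgp, ?_⟩
  · exact @continuous_of_norm_le_seminorm E _ _ τ.top τ.polynormableSpace g p hp hgp
  · have h1 := hg ⟨(1 : ℂ) • x, Submodule.smul_mem _ _ (Submodule.mem_span_singleton_self x)⟩
    rw [hf] at h1
    simp only [one_smul, mul_one] at h1
    change ‖g x‖ = _
    rw [h1, Complex.norm_real, Real.norm_of_nonneg (apply_nonneg p x)]

theorem IsFunctional.isSeminorm {φ : E →L[ℂ] ℂ} (hφ : τ.IsFunctional φ) :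
    τ.IsSeminorm ((normSeminorm ℂ ℂ).comp φ.toLinearMap) :=
  @Continuous.comp E ℂ ℝ τ.top _ _ φ _ continuous_norm hφ

theorem IsFunctional.tendsto {φ : E →L[ℂ] ℂ} (hφ : τ.IsFunctional φ) {ι : Type*} {u : ι → E}
    {l : Filter ι} {x : E} (h : Tendsto u l (τ.nhds x)) :
    Tendsto (fun i => φ (u i)) l (𝓝 (φ x)) :=
  (@Continuous.tendsto E ℂ τ.top _ φ hφ x).comp h

theorem norm_le_of_forall_functional {x : E} {c : ℝ}
    (h : ∀ φ, τ.IsFunctional φ → ‖φ‖ ≤ 1 → ‖φ x‖ ≤ c) : ‖x‖ ≤ c := by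
  refine (τ.norming x).2 ?_
  rintro r ⟨φ, hφ, hb, rfl⟩
  let ψ : E →L[ℂ] ℂ := φ.mkContinuous 1 (by simpa using hb)
  exact h ψ hφ (φ.mkContinuous_norm_le zero_le_one _)

theorem eq_of_forall_functional {x y : E} (h : ∀ φ, τ.IsFunctional φ → φ x = φ y) : x = y := by
  rw [← sub_eq_zero, ← norm_le_zero_iff]
  refine norm_le_of_forall_functional (τ := τ) fun φ hφ _ => ?_
  simp [h φ hφ]

theorem tendsto_of_tendsto_norm {ι : Type*} {u : ι → E} {l : Filter ι} {x : E}
    (h : Tendsto u l (𝓝 x)) : Tendsto u l (τ.nhds x) := by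
  have h2 : Tendsto id (𝓝 x) (τ.nhds x) := @Continuous.tendsto E E (normTopology E) τ.top id τ.coarser x
  exact h2.comp h

/-- The norm is τ-lower semicontinuous, being a supremum of moduli of τ-continuous functionals. -/
theorem norm_le_of_tendsto {ι : Type*} {u : ι → E} {l : Filter ι} [NeBot l] {x : E} {b : ι → ℝ}
    {c : ℝ} (h : Tendsto u l (τ.nhds x)) (hb : ∀ᶠ i in l, ‖u i‖ ≤ b i) (hc : Tendsto b l (𝓝 c)) :
    ‖x‖ ≤ c := by
  refine norm_le_of_forall_functional (τ := τ) fun φ hφ h1 => ?_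
  refine le_of_tendsto_of_tendsto (hφ.tendsto h).norm hc ?_
  filter_upwards [hb] with i hi
  exact (φ.le_of_opNorm_le h1 _).trans (by simpa using hi)

theorem tendsto_nhds_unique {ι : Type*} {u : ι → E} {l : Filter ι} [NeBot l] {x y : E}
    (hx : Tendsto u l (τ.nhds x)) (hy : Tendsto u l (τ.nhds y)) : x = y :=
  eq_of_forall_functional (τ := τ) fun _ hφ =>
    _root_.tendsto_nhds_unique (hφ.tendsto hx) (hφ.tendsto hy)

theorem tendsto_add {ι : Type*} {u v : ι → E} {l : Filter ι} {x y : E}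
    (hx : Tendsto u l (τ.nhds x)) (hy : Tendsto v l (τ.nhds y)) :
    Tendsto (fun i => u i + v i) l (τ.nhds (x + y)) := by
  rw [tendsto_iff] at *
  intro p hp
  refine squeeze_zero (fun _ => apply_nonneg p _) (fun i => ?_)
    (by simpa using (hx p hp).add (hy p hp))
  rw [add_sub_add_comm]
  exact map_add_le_add p _ _

theorem tendsto_const_smul {ι : Type*} {u : ι → E} {l : Filter ι} {x : E} (c : ℂ)
    (hx : Tendsto u l (τ.nhds x)) : Tendsto (fun i => c • u i) l (τ.nhds (c • x)) := by
  rw [tendsto_iff] at *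
  intro p hp
  simpa [← smul_sub, map_smul_eq_mul] using (hx p hp).const_mul ‖c‖

theorem tendsto_sub {ι : Type*} {u v : ι → E} {l : Filter ι} {x y : E}
    (hx : Tendsto u l (τ.nhds x)) (hy : Tendsto v l (τ.nhds y)) :
    Tendsto (fun i => u i - v i) l (τ.nhds (x - y)) := by
  simpa [sub_eq_add_neg] using tendsto_add hx (tendsto_const_smul (-1) hy)

theorem exists_tendsto_of_cauchy {u : ℕ → E} {C : ℝ} (hC : ∀ n, ‖u n‖ ≤ C)
    (hu : ∀ p, τ.IsSeminorm p → ∀ ε > 0, ∃ N, ∀ m ≥ N, ∀ n ≥ N, p (u m - u n) < ε) :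
    ∃ x, Tendsto u atTop (τ.nhds x) := by
  -- Completeness is only assumed on the unit ball; the maximum with 1 makes the rescaling
  -- invertible even if `C = 0`.
  set D : ℝ := max C 1
  have hD : 0 < D := lt_of_lt_of_le one_pos (le_max_right _ _)
  have hD' : (D : ℂ) ≠ 0 := by exact_mod_cast hD.ne'
  have hb (n : ℕ) : ‖(D : ℂ)⁻¹ • u n‖ ≤ 1 := by
    rw [norm_smul, norm_inv, Complex.norm_real, Real.norm_of_nonneg hD.le, inv_mul_le_iff₀ hD]
    exact (hC n).trans ((le_max_left _ _).trans_eq (mul_one _).symm)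
  obtain ⟨x, -, hx⟩ := τ.seqComplete (fun n => (D : ℂ)⁻¹ • u n) hb fun U hU => by
    obtain ⟨p, hp, ε, hε, h⟩ := exists_seminorm_of_mem_nhds (τ := τ) hU
    obtain ⟨N, hN⟩ := hu p hp (D * ε) (by positivity)
    refine ⟨N, fun m hm n hn => h _ ?_⟩
    rw [← smul_sub, map_smul_eq_mul, norm_inv, Complex.norm_real, Real.norm_of_nonneg hD.le,
      inv_mul_lt_iff₀ hD]
    exact hN m hm n hn
  refine ⟨(D : ℂ) • x, ?_⟩
  simpa [smul_smul, hD'] using tendsto_const_smul (τ := τ) (D : ℂ) hx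

end CoarseTopology

theorem biEquicontinuous_iff {τ : CoarseTopology E} {ι : Type*} {S : ι → E →L[ℂ] E} :
    BiEquicontinuous τ S ↔ ∀ u : ℕ → E, (∃ C : ℝ, ∀ n, ‖u n‖ ≤ C) →
      Tendsto u atTop (τ.nhds 0) → ∀ p, τ.IsSeminorm p → ∀ ε > 0,
        ∀ᶠ n in atTop, ∀ i, p (S i (u n)) < ε := by
  refine forall₃_congr fun u _ _ => ⟨fun h p hp ε hε => ?_, fun h U hU => ?_⟩
  · exact h _ (hp.mem_nhds hε)
  · obtain ⟨p, hp, ε, hε, H⟩ := CoarseTopology.exists_seminorm_of_mem_nhds hU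
    filter_upwards [h p hp ε hε] with n hn i using H _ (hn i)

/-! ### Weak integrals of `τ`-continuous functions -/

section WeakIntegral

open MeasureTheory

/-- The operator `S` maps norm-bounded `τ`-null sequences to `τ`-null sequences. -/
def SeqContinuous (τ : CoarseTopology E) (S : E →L[ℂ] E) : Prop :=
  ∀ u : ℕ → E, (∃ C : ℝ, ∀ n, ‖u n‖ ≤ C) → Tendsto u atTop (τ.nhds 0) →
    Tendsto (fun n => S (u n)) atTop (τ.nhds 0)

variable {τ : CoarseTopology E}

theorem seqContinuous_id : SeqContinuous τ (ContinuousLinearMap.id ℂ E) := fun _ _ h => h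

theorem BiEquicontinuous.seqContinuous {ι : Type*} {S : ι → E →L[ℂ] E}
    (h : BiEquicontinuous τ S) (i : ι) : SeqContinuous τ (S i) := by
  intro u hu h0
  rw [CoarseTopology.tendsto_zero_iff]
  intro p hp
  rw [Metric.tendsto_nhds]
  intro ε hε
  filter_upwards [biEquicontinuous_iff.1 h u hu h0 p hp ε hε] with n hn
  simpa [abs_of_nonneg (apply_nonneg p _)] using hn i

theorem SeqContinuous.tendsto {S : E →L[ℂ] E} (hS : SeqContinuous τ S) {u : ℕ → E} {x : E} {C : ℝ}
    (hC : ∀ᶠ n in atTop, ‖u n‖ ≤ C) (hu : Tendsto u atTop (τ.nhds x)) :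
    Tendsto (fun n => S (u n)) atTop (τ.nhds (S x)) := by
  rw [← CoarseTopology.tendsto_sub_iff] at hu ⊢
  obtain ⟨N, hN⟩ := eventually_atTop.1 hC
  -- The bound holds only eventually, so the sequence is shifted to be bounded from the start.
  have h := hS (fun n => u (n + N) - x) ⟨C + ‖x‖, fun n => (norm_sub_le _ _).trans
    (add_le_add_left (hN _ (Nat.le_add_left _ _)) _)⟩ (hu.comp (tendsto_add_atTop_nat N))
  simp only [map_sub] at h
  rw [CoarseTopology.tendsto_zero_iff] at h ⊢
  intro p hp
  exact (tendsto_add_atTop_iff_nat (f := fun n => p (S (u n) - S x)) N).1 (h p hp)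

theorem tendsto_floor_mul_div (t : ℝ) :
    Tendsto (fun n : ℕ => (⌊((n : ℝ) + 1) * t⌋ : ℝ) / (n + 1)) atTop (𝓝 t) := by
  refine tendsto_iff_norm_sub_tendsto_zero.2 (squeeze_zero (fun _ => norm_nonneg _) (fun n => ?_)
    (tendsto_one_div_add_atTop_nhds_zero_nat (𝕜 := ℝ)))
  have hn : (0 : ℝ) < n + 1 := by positivity
  rw [div_sub' hn.ne', norm_div, Real.norm_of_nonneg hn.le]
  gcongr
  rw [Real.norm_eq_abs, abs_le]
  constructor <;> linarith [Int.floor_le (((n : ℝ) + 1) * t), Int.lt_floor_add_one (((n : ℝ) + 1) * t)]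

/-- The step functions `g n`, constant on cells of mesh 1/(n+1), are Bochner integrable against `w`.
Dominated convergence applied to p(g m - g n) makes their integrals τ-Cauchy. The operator `S` is
part of the conclusion because φ ∘ S is controlled only along bounded sequences and need not be
τ-continuous; with it, T(t) can be moved under the integral. -/
theorem exists_weakIntegral [CompleteSpace E] {μ : Measure ℝ} {w : ℝ → ℝ} (hw : Integrable w μ)
    {f : ℝ → E} (hf : ∀ t, Tendsto f (𝓝 t) (τ.nhds (f t))) {C : ℝ} (hC : ∀ t, ‖f t‖ ≤ C) :
    ∃ y, ∀ S, SeqContinuous τ S → ∀ φ, τ.IsFunctional φ →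
      φ (S y) = ∫ t, w t • φ (S (f t)) ∂μ := by
  have hC0 : 0 ≤ C := (norm_nonneg _).trans (hC 0)
  set g : ℕ → ℝ → E := fun n t => f ((⌊((n : ℝ) + 1) * t⌋ : ℝ) / (n + 1)) with hg
  have hgm (n : ℕ) : StronglyMeasurable (g n) := by
    -- Measurability is free here: `g n` factors through the discrete space ℤ.
    have h1 : StronglyMeasurable fun z : ℤ => f ((z : ℝ) / (n + 1)) := .of_discrete
    exact h1.comp_measurable (g := fun t : ℝ => ⌊((n : ℝ) + 1) * t⌋)
      (Int.measurable_floor.comp (measurable_const.mul measurable_id))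
  have hgt (t : ℝ) : Tendsto (fun n => g n t) atTop (τ.nhds (f t)) :=
    (hf t).comp (tendsto_floor_mul_div t)
  have hint (n : ℕ) : Integrable (fun t => w t • g n t) μ := by
    refine (hw.norm.mul_const C).mono' (hw.aestronglyMeasurable.smul
      (hgm n).aestronglyMeasurable) (.of_forall fun t => ?_)
    rw [norm_smul]
    exact mul_le_mul_of_nonneg_left (hC _) (norm_nonneg _)
  have hL (n : ℕ) (ψ : E →L[ℂ] ℂ) :
      ψ (∫ t, w t • g n t ∂μ) = ∫ t, w t • ψ (g n t) ∂μ := by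
    rw [← ψ.integral_comp_comm (hint n)]
    exact integral_congr_ae (.of_forall fun t => ψ.map_smul_of_tower _ _)
  have hlim (S : E →L[ℂ] E) (hS : SeqContinuous τ S) (φ : E →L[ℂ] ℂ) (hφ : τ.IsFunctional φ) :
      Tendsto (fun n => φ (S (∫ t, w t • g n t ∂μ))) atTop
        (𝓝 (∫ t, w t • φ (S (f t)) ∂μ)) := by
    have h1 (n : ℕ) := hL n (φ.comp S)
    simp only [ContinuousLinearMap.comp_apply] at h1
    simp only [h1]
    refine tendsto_integral_of_dominated_convergence (fun t => ‖w t‖ * (‖φ.comp S‖ * C))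
      (fun n => ?_) (hw.norm.mul_const _) (fun n => .of_forall fun t => ?_)
      (.of_forall fun t => ?_)
    · exact hw.aestronglyMeasurable.smul
        ((φ.comp S).continuous.comp_stronglyMeasurable (hgm n)).aestronglyMeasurable
    · rw [norm_smul]
      gcongr
      exact (φ.comp S).le_opNorm_of_le (hC _)
    · exact (hφ.tendsto (hS.tendsto (.of_forall fun n => hC _) (hgt t))).const_smul _
  obtain ⟨y, hy⟩ := CoarseTopology.exists_tendsto_of_cauchy (τ := τ)
      (u := fun n => ∫ t, w t • g n t ∂μ) (C := ∫ t, ‖w t‖ * C ∂μ) (fun n => by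
    refine norm_integral_le_of_norm_le (hw.norm.mul_const _) (.of_forall fun t => ?_)
    rw [norm_smul]
    exact mul_le_mul_of_nonneg_left (hC _) (norm_nonneg _)) (fun p hp ε hε => by
    obtain ⟨D, hD, hpD⟩ := hp.exists_bound
    have hlim0 : Tendsto (fun k : ℕ × ℕ => ∫ t, ‖w t‖ * p (g k.1 t - g k.2 t) ∂μ) (atTop ×ˢ atTop)
        (𝓝 (∫ t, (0 : ℝ) ∂μ)) := by
      refine tendsto_integral_filter_of_dominated_convergence (fun t => ‖w t‖ * (D * (C + C)))
        (.of_forall fun k => ?_) (.of_forall fun k => .of_forall fun t => ?_)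
        (hw.norm.mul_const _) (.of_forall fun t => ?_)
      · exact hw.norm.aestronglyMeasurable.mul (hp.continuous.comp_stronglyMeasurable
          ((hgm k.1).sub (hgm k.2))).aestronglyMeasurable
      · rw [norm_mul, norm_norm, Real.norm_of_nonneg (apply_nonneg p _)]
        gcongr
        refine (hpD _).trans ?_
        gcongr
        exact (norm_sub_le _ _).trans (add_le_add (hC _) (hC _))
      · have h1 := CoarseTopology.tendsto_iff.1 (hgt t) p hp
        have h2 : Tendsto (fun k : ℕ × ℕ => p (g k.1 t - f t) + p (g k.2 t - f t))
            (atTop ×ˢ atTop) (𝓝 0) := by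
          simpa using (h1.comp tendsto_fst).add (h1.comp tendsto_snd)
        have h3 : Tendsto (fun k : ℕ × ℕ => p (g k.1 t - g k.2 t)) (atTop ×ˢ atTop) (𝓝 0) := by
          refine squeeze_zero (fun _ => apply_nonneg p _) (fun k => ?_) h2
          calc p (g k.1 t - g k.2 t) = p ((g k.1 t - f t) - (g k.2 t - f t)) := by simp
            _ ≤ _ := map_sub_le_add p _ _
        simpa using h3.const_mul ‖w t‖
    rw [integral_zero, prod_atTop_atTop_eq] at hlim0
    obtain ⟨N, hN⟩ := eventually_atTop.1 (hlim0.eventually_lt_const hε)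
    refine ⟨max N.1 N.2, fun m hm n hn => lt_of_le_of_lt ?_ (hN (m, n)
      ⟨(le_max_left _ _).trans hm, (le_max_right _ _).trans hn⟩)⟩
    -- One functional attaining p at the difference moves the seminorm inside the integral.
    obtain ⟨φ, hφ, hφp, hφe⟩ :=
      CoarseTopology.exists_functional hp (∫ t, w t • g m t ∂μ - ∫ t, w t • g n t ∂μ)
    have hsub : ∫ t, w t • g m t ∂μ - ∫ t, w t • g n t ∂μ = ∫ t, w t • (g m t - g n t) ∂μ := by
      rw [← integral_sub (hint m) (hint n)]
      simp only [smul_sub]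
    have hint2 : Integrable (fun t => w t • (g m t - g n t)) μ := by
      simp only [smul_sub]
      exact (hint m).sub (hint n)
    rw [← hφe, hsub, ← φ.integral_comp_comm hint2]
    have hint3 : Integrable (fun t => ‖w t‖ * p (g m t - g n t)) μ := by
      refine (hw.norm.mul_const (D * (C + C))).mono' (hw.norm.aestronglyMeasurable.mul
        (hp.continuous.comp_stronglyMeasurable ((hgm m).sub (hgm n))).aestronglyMeasurable)
        (.of_forall fun t => ?_)
      rw [norm_mul, norm_norm, Real.norm_of_nonneg (apply_nonneg p _)]
      gcongr
      refine (hpD _).trans ?_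
      gcongr
      exact (norm_sub_le _ _).trans (add_le_add (hC _) (hC _))
    refine norm_integral_le_of_norm_le hint3 (.of_forall fun t => ?_)
    rw [φ.map_smul_of_tower, norm_smul]
    gcongr
    exact hφp _)
  refine ⟨y, fun S hS φ hφ => tendsto_nhds_unique (hφ.tendsto (hS.tendsto (C := ∫ t, ‖w t‖ * C ∂μ)
    (.of_forall fun n => ?_) hy)) (hlim S hS φ hφ)⟩
  refine norm_integral_le_of_norm_le (hw.norm.mul_const _) (.of_forall fun t => ?_)
  rw [norm_smul]
  exact mul_le_mul_of_nonneg_left (hC _) (norm_nonneg _)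

end WeakIntegral

/-! ### Orbits of a bi-continuous semigroup -/

section Orbits

open MeasureTheory Set

theorem CoarseTopology.tendsto_smul {τ : CoarseTopology E} {ι : Type*} {c : ι → ℂ} {u : ι → E}
    {l : Filter ι} {a : ℂ} {x : E} (hc : Tendsto c l (𝓝 a)) (hu : Tendsto u l (τ.nhds x)) :
    Tendsto (fun i => c i • u i) l (τ.nhds (a • x)) := by
  rw [tendsto_iff] at *
  intro p hp
  have h1 := (hc.norm.mul (hu p hp)).add ((hc.sub_const a).norm.mul_const (p x))
  simp only [sub_self, norm_zero, mul_zero, zero_mul, add_zero] at h1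
  refine squeeze_zero (fun _ => apply_nonneg p _) (fun i => ?_) h1
  rw [show c i • u i - a • x = c i • (u i - x) + (c i - a) • x by
    rw [smul_sub, sub_smul]; abel, ← map_smul_eq_mul, ← map_smul_eq_mul]
  exact map_add_le_add p _ _

/-- The family `T` as a function on `ℝ`, constant on `(-∞, 0]`. -/
def onReal (T : ℝ≥0 → E →L[ℂ] E) (t : ℝ) : E →L[ℂ] E := T t.toNNReal

variable {τ : CoarseTopology E} {T : ℝ≥0 → E →L[ℂ] E} {M ω : ℝ}

theorem onReal_coe (t : ℝ≥0) : onReal T t = T t := by simp [onReal]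

theorem HasType.nonneg (h : HasType T M ω) : 0 ≤ M :=
  nonneg_of_mul_nonneg_left ((norm_nonneg _).trans (h 0)) (Real.exp_pos _)

theorem HasType.norm_onReal_le (h : HasType T M ω) {t : ℝ} (ht : 0 ≤ t) (x : E) :
    ‖onReal T t x‖ ≤ M * Real.exp (ω * t) * ‖x‖ := by
  have := (T t.toNNReal).le_of_opNorm_le (h t.toNNReal) x
  rwa [Real.coe_toNNReal t ht] at this

theorem HasType.norm_onReal_le_of_le (h : HasType T M ω) {t b : ℝ} (ht : 0 ≤ t) (htb : t ≤ b)
    (x : E) : ‖onReal T t x‖ ≤ M * Real.exp (|ω| * b) * ‖x‖ := by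
  have hM := h.nonneg
  refine (h.norm_onReal_le ht x).trans ?_
  gcongr
  exact le_abs_self _

namespace IsBiContinuousSemigroup

variable (hT : IsBiContinuousSemigroup τ T)

include hT

theorem onReal_zero : onReal T 0 = ContinuousLinearMap.id ℂ E := by
  simp [onReal, hT.map_zero]

theorem onReal_add {s t : ℝ} (hs : 0 ≤ s) (ht : 0 ≤ t) (x : E) :
    onReal T (s + t) x = onReal T s (onReal T t x) := by
  rw [onReal, Real.toNNReal_add hs ht, hT.map_add]
  rfl

theorem tendsto_onReal (x : E) (t : ℝ) :
    Tendsto (fun r => onReal T r x) (𝓝 t) (τ.nhds (onReal T t x)) := by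
  have h : Tendsto (fun r => T r x) (𝓝 t.toNNReal) (τ.nhds (T t.toNNReal x)) :=
    @Continuous.tendsto ℝ≥0 E _ τ.top _ (hT.strongly_continuous x) t.toNNReal
  exact h.comp (continuous_real_toNNReal.tendsto t)

theorem continuous_functional {φ : E →L[ℂ] ℂ} (hφ : τ.IsFunctional φ) (x : E) :
    Continuous fun t => φ (onReal T t x) :=
  continuous_iff_continuousAt.2 fun t => hφ.tendsto (hT.tendsto_onReal x t)

theorem seqContinuous (t : ℝ) : SeqContinuous τ (onReal T t) :=
  (hT.locally_biequicontinuous t.toNNReal).seqContinuous ⟨t.toNNReal, le_refl t.toNNReal⟩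

/-- The growth e^{ωt} is shifted from the orbit to the weight, so that the bounded case applies. The
`max t 0` keeps the rescaled orbit bounded for negative t as well. -/
theorem exists_weakIntegral [CompleteSpace E] (h : HasType T M ω) {w : ℝ → ℝ}
    (hw : IntegrableOn (fun t => w t * Real.exp (ω * t)) (Ioi 0)) (x : E) :
    ∃ y, ∀ S, SeqContinuous τ S → ∀ φ, τ.IsFunctional φ →
      φ (S y) = ∫ t in Ioi 0, w t • φ (S (onReal T t x)) := by
  have hM := h.nonneg
  have hf (t : ℝ) : Tendsto (fun t => (Real.exp (-(ω * max t 0)) : ℂ) • onReal T t x) (𝓝 t)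
      (τ.nhds ((Real.exp (-(ω * max t 0)) : ℂ) • onReal T t x)) :=
    CoarseTopology.tendsto_smul (Continuous.tendsto (by fun_prop) t) (hT.tendsto_onReal x t)
  have hb (t : ℝ) : ‖(Real.exp (-(ω * max t 0)) : ℂ) • onReal T t x‖ ≤ M * ‖x‖ := by
    have h1 : onReal T t x = onReal T (max t 0) x := by
      rw [onReal, onReal, ← Real.toNNReal_coe (r := t.toNNReal), Real.coe_toNNReal']
    rw [norm_smul, h1, Complex.norm_real, Real.norm_of_nonneg (Real.exp_pos _).le]
    refine (mul_le_mul_of_nonneg_left (h.norm_onReal_le (le_max_right t 0) x)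
      (Real.exp_pos _).le).trans (le_of_eq ?_)
    rw [Real.exp_neg]
    field_simp
  obtain ⟨y, hy⟩ := BiCont.exists_weakIntegral (τ := τ) hw hf hb
  refine ⟨y, fun S hS φ hφ => ?_⟩
  rw [hy S hS φ hφ]
  refine setIntegral_congr_fun measurableSet_Ioi fun t (ht : 0 < t) => ?_
  simp only [max_eq_left ht.le, map_smul, Complex.real_smul, smul_eq_mul]
  push_cast
  rw [← mul_assoc, mul_assoc (w t : ℂ), ← Complex.exp_add]
  simp

end IsBiContinuousSemigroup

/-! ### The generator in integrated form -/

/-- The defining relation of the generator of `T`. -/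
def GenRel (τ : CoarseTopology E) (T : ℝ≥0 → E →L[ℂ] E) (x y : E) : Prop :=
  Tendsto (fun t : ℝ≥0 => (t : ℝ)⁻¹ • (T t x - x)) (𝓝[>] 0) (τ.nhds y) ∧
    ∃ C : ℝ, ∀ t : ℝ≥0, 0 < t → t ≤ 1 → ‖(t : ℝ)⁻¹ • (T t x - x)‖ ≤ C

/-- The weak integral equation `T(t)x - x = ∫₀ᵗ T(r)y dr`. -/
def IntRel (τ : CoarseTopology E) (T : ℝ≥0 → E →L[ℂ] E) (x y : E) : Prop :=
  ∀ φ, τ.IsFunctional φ → ∀ t : ℝ, 0 ≤ t →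
    φ (onReal T t x) - φ x = ∫ r in (0 : ℝ)..t, φ (onReal T r y)

theorem seminorm_le_of_weakIntegral {p : Seminorm ℂ E} (hp : τ.IsSeminorm p) {z : E} {t c : ℝ}
    {F : ℝ → E} (ht : 0 ≤ t) (hz : ∀ φ, τ.IsFunctional φ → φ z = ∫ r in (0 : ℝ)..t, φ (F r))
    (hF : ∀ r, 0 < r → r ≤ t → p (F r) ≤ c) : p z ≤ c * t := by
  obtain ⟨φ, hφ, hφp, hφz⟩ := CoarseTopology.exists_functional hp z
  rw [← hφz, hz φ hφ]
  have := intervalIntegral.norm_integral_le_of_norm_le_const (a := 0) (b := t) (C := c)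
    (f := fun r => φ (F r)) fun r hr => by
      rw [uIoc_of_le ht] at hr
      exact (hφp _).trans (hF r hr.1 hr.2)
  simpa [abs_of_nonneg ht] using this

theorem norm_le_of_weakIntegral {z : E} {t c : ℝ}
    {F : ℝ → E} (ht : 0 ≤ t) (hz : ∀ φ, τ.IsFunctional φ → φ z = ∫ r in (0 : ℝ)..t, φ (F r))
    (hF : ∀ r, 0 < r → r ≤ t → ‖F r‖ ≤ c) : ‖z‖ ≤ c * t := by
  refine CoarseTopology.norm_le_of_forall_functional (τ := τ) fun φ hφ h1 => ?_
  rw [hz φ hφ]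
  have := intervalIntegral.norm_integral_le_of_norm_le_const (a := 0) (b := t) (C := c)
    (f := fun r => φ (F r)) fun r hr => by
      rw [uIoc_of_le ht] at hr
      exact (φ.le_of_opNorm_le h1 _).trans (by simpa using hF r hr.1 hr.2)
  simpa [abs_of_nonneg ht] using this

theorem IntRel.norm_sub_le {x y : E} (h : IntRel τ T x y) {t c : ℝ} (ht : 0 ≤ t)
    (hc : ∀ r, 0 < r → r ≤ t → ‖onReal T r y‖ ≤ c) : ‖onReal T t x - x‖ ≤ c * t :=
  norm_le_of_weakIntegral (τ := τ) ht (fun φ hφ => by rw [map_sub, h φ hφ t ht]) hc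

variable (hT : IsBiContinuousSemigroup τ T)

include hT

theorem IntRel.weakIntegral_sub {x y : E} (h : IntRel τ T x y) {t : ℝ} (ht : 0 ≤ t)
    (φ : E →L[ℂ] ℂ) (hφ : τ.IsFunctional φ) :
    φ (onReal T t x - x - (t : ℂ) • y) = ∫ r in (0 : ℝ)..t, φ (onReal T r y - y) := by
  simp only [map_sub, map_smul, h φ hφ t ht]
  rw [intervalIntegral.integral_sub ((hT.continuous_functional hφ y).intervalIntegrable _ _)
    intervalIntegrable_const]
  simp

theorem IntRel.seminorm_sub_sub_le {x y : E} (h : IntRel τ T x y) {p : Seminorm ℂ E}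
    (hp : τ.IsSeminorm p) {t c : ℝ} (ht : 0 ≤ t)
    (hc : ∀ r, 0 < r → r ≤ t → p (onReal T r y - y) ≤ c) :
    p (onReal T t x - x - (t : ℂ) • y) ≤ c * t :=
  seminorm_le_of_weakIntegral hp ht (h.weakIntegral_sub hT ht) hc

theorem IntRel.norm_sub_sub_le {x y : E} (h : IntRel τ T x y) {t c : ℝ} (ht : 0 ≤ t)
    (hc : ∀ r, 0 < r → r ≤ t → ‖onReal T r y - y‖ ≤ c) :
    ‖onReal T t x - x - (t : ℂ) • y‖ ≤ c * t :=
  norm_le_of_weakIntegral (τ := τ) ht (h.weakIntegral_sub hT ht) hc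

/-- The function φ(T(r)x) is continuous with right derivative φ(T(r)y), which suffices for the
fundamental theorem of calculus. Since T(r) respects τ-limits only along norm-bounded sequences, the
derivative is computed along sequences and the boundedness of the difference quotients is essential.
-/
theorem GenRel.intRel {x y : E} (h : GenRel τ T x y) : IntRel τ T x y := by
  intro φ hφ t ht
  obtain ⟨h1, C, hC⟩ := h
  rw [intervalIntegral.integral_eq_sub_of_hasDeriv_right (f := fun r => φ (onReal T r x))
    (hT.continuous_functional hφ x).continuousOn (fun r hr => ?_)
    ((hT.continuous_functional hφ y).intervalIntegrable _ _)]
  · simp [hT.onReal_zero]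
  · rw [min_eq_left ht] at hr
    rw [hasDerivWithinAt_iff_tendsto_slope' (by simp)]
    refine tendsto_of_seq_tendsto fun s hs => ?_
    rw [tendsto_nhdsWithin_iff] at hs
    have hk : Tendsto (fun n => (s n - r).toNNReal) atTop (𝓝[>] 0) := by
      refine tendsto_nhdsWithin_iff.2 ⟨?_, ?_⟩
      · simpa [Function.comp_def] using (continuous_real_toNNReal.tendsto _).comp (hs.1.sub_const r)
      · filter_upwards [hs.2] with n hn
        simpa using hn
    have h2 : Tendsto (fun n => φ (onReal T r ((((s n - r).toNNReal : ℝ≥0) : ℝ)⁻¹ •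
        (T (s n - r).toNNReal x - x)))) atTop (𝓝 (φ (onReal T r y))) := by
      refine hφ.tendsto ((hT.seqContinuous r).tendsto (C := C) ?_ (h1.comp hk))
      have h3 := tendsto_nhdsWithin_iff.1 hk
      filter_upwards [h3.2, h3.1.eventually_le_const zero_lt_one] with n hn hn1
      exact hC _ hn hn1
    refine h2.congr' ?_
    filter_upwards [hs.2] with n hn
    have hn' : 0 < s n - r := sub_pos.2 hn
    rw [Function.comp_apply, Real.coe_toNNReal _ hn'.le, slope_def_module,
      ContinuousLinearMap.map_smul_of_tower, ContinuousLinearMap.map_smul_of_tower, map_sub, map_sub]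
    congr 3
    have h3 := hT.onReal_add hr.1.le hn'.le x
    rw [add_sub_cancel] at h3
    exact h3.symm

/-- The difference quotient is the mean of T(r)y over (0, t): τ-continuity at 0 gives the limit,
local boundedness gives the norm bound. -/
theorem IntRel.genRel {x y : E} (h : IntRel τ T x y) : GenRel τ T x y := by
  obtain ⟨M, ω, hM, hTM⟩ := hT.exponentially_bounded
  have hsm (t : ℝ≥0) (z : E) : (t : ℝ)⁻¹ • z = ((t : ℝ) : ℂ)⁻¹ • z := by
    rw [← Complex.ofReal_inv, Complex.coe_smul]
  refine ⟨CoarseTopology.tendsto_iff.2 fun p hp => ?_, M * Real.exp (|ω| * 1) * ‖y‖,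
    fun t ht ht1 => ?_⟩
  · rw [Metric.tendsto_nhds]
    intro ε hε
    have h1 := CoarseTopology.tendsto_iff.1 (hT.tendsto_onReal y 0) p hp
    simp only [hT.onReal_zero, ContinuousLinearMap.id_apply] at h1
    obtain ⟨δ, hδ, hb⟩ := Metric.eventually_nhds_iff.1 (h1.eventually_lt_const (half_pos hε))
    have hev : ∀ᶠ t : ℝ≥0 in 𝓝[>] 0, (t : ℝ) < δ :=
      (NNReal.continuous_coe.tendsto' 0 0 rfl).mono_left nhdsWithin_le_nhds
        |>.eventually_lt_const hδ
    filter_upwards [hev, self_mem_nhdsWithin] with t htδ (ht : 0 < t)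
    have ht' : (0 : ℝ) < t := ht
    have h2 := h.seminorm_sub_sub_le hT hp ht'.le (c := ε / 2) fun r hr hrt =>
      (hb (by rw [Real.dist_eq, sub_zero, abs_of_pos hr]; linarith)).le
    rw [Real.dist_eq, sub_zero, abs_of_nonneg (apply_nonneg p _), hsm]
    have hne : ((t : ℝ) : ℂ) ≠ 0 := by exact_mod_cast ht'.ne'
    have h3 : ((t : ℝ) : ℂ)⁻¹ • (T t x - x) - y
        = ((t : ℝ) : ℂ)⁻¹ • (onReal T t x - x - ((t : ℝ) : ℂ) • y) := by
      rw [smul_sub _ _ (((t : ℝ) : ℂ) • y), smul_smul, inv_mul_cancel₀ hne, one_smul, onReal_coe]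
    rw [h3, map_smul_eq_mul, norm_inv, Complex.norm_real, Real.norm_of_nonneg ht'.le,
      inv_mul_lt_iff₀ ht']
    nlinarith
  · have ht' : (0 : ℝ) < t := ht
    have h2 := h.norm_sub_le ht'.le fun r hr hrt =>
      hTM.norm_onReal_le_of_le hr.le (hrt.trans (by exact_mod_cast ht1)) y
    rw [norm_smul, norm_inv, Real.norm_of_nonneg ht'.le, inv_mul_le_iff₀ ht', mul_comm, ← onReal_coe (T := T)]
    exact h2

theorem genRel_iff_intRel {x y : E} : GenRel τ T x y ↔ IntRel τ T x y :=
  ⟨fun h => h.intRel hT, fun h => h.genRel hT⟩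

/-- The generator is closed under bounded τ-limits, by dominated convergence in the integrated
relation. -/
theorem intRel_of_tendsto {u v : ℕ → E} {x y : E} {C D : ℝ} (huv : ∀ n, IntRel τ T (u n) (v n))
    (hC : ∀ n, ‖u n‖ ≤ C) (hD : ∀ n, ‖v n‖ ≤ D) (hu : Tendsto u atTop (τ.nhds x))
    (hv : Tendsto v atTop (τ.nhds y)) : IntRel τ T x y := by
  obtain ⟨M, ω, hM, hTM⟩ := hT.exponentially_bounded
  intro φ hφ t ht
  have h1 : Tendsto (fun n => φ (onReal T t (u n)) - φ (u n)) atTop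
      (𝓝 (φ (onReal T t x) - φ x)) :=
    (hφ.tendsto ((hT.seqContinuous t).tendsto (.of_forall hC) hu)).sub (hφ.tendsto hu)
  refine tendsto_nhds_unique h1 ?_
  simp only [fun n => huv n φ hφ t ht]
  refine intervalIntegral.tendsto_integral_filter_of_dominated_convergence
    (fun _ => ‖φ‖ * (M * Real.exp (|ω| * t) * D)) (.of_forall fun n =>
      (hT.continuous_functional hφ _).aestronglyMeasurable) (.of_forall fun n => .of_forall
      fun r hr => ?_) intervalIntegrable_const (.of_forall fun r _ => ?_)
  · rw [uIoc_of_le ht] at hr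
    refine φ.le_opNorm_of_le ((hTM.norm_onReal_le_of_le hr.1.le hr.2 _).trans ?_)
    have := hTM.nonneg
    gcongr
    exact hD n
  · exact hφ.tendsto ((hT.seqContinuous r).tendsto (.of_forall hD) hv)

/-- The mean ∫₀ᵗ T(r)x dr lies in the domain: shifting it by s and integrating T(r)(T(t)x - x) over
[0, s] leave the same boundary pieces of the orbit integral. -/
theorem exists_average [CompleteSpace E] (x : E) {t : ℝ} (ht : 0 ≤ t) :
    ∃ y, (∀ φ, τ.IsFunctional φ → φ y = ∫ r in (0 : ℝ)..t, φ (onReal T r x)) ∧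
      IntRel τ T y (onReal T t x - x) := by
  obtain ⟨M, ω, hM, hTM⟩ := hT.exponentially_bounded
  obtain ⟨y, hy⟩ := hT.exists_weakIntegral hTM (w := (Iic t).indicator fun _ => 1) (by
    have : (fun r => (Iic t).indicator (fun _ => (1 : ℝ)) r * Real.exp (ω * r)) =
        (Iic t).indicator fun r => Real.exp (ω * r) := by
      ext r
      by_cases hr : r ∈ Iic t <;> simp [hr]
    rw [this, integrableOn_indicator_iff measurableSet_Iic, inter_comm, Ioi_inter_Iic]
    exact (Continuous.integrableOn_Icc (by fun_prop)).mono_set Ioc_subset_Icc_self) x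
  have hy' (S : E →L[ℂ] E) (hS : SeqContinuous τ S) (φ : E →L[ℂ] ℂ) (hφ : τ.IsFunctional φ) :
      φ (S y) = ∫ r in (0 : ℝ)..t, φ (S (onReal T r x)) := by
    rw [hy S hS φ hφ, intervalIntegral.integral_of_le ht, ← Ioi_inter_Iic,
      ← setIntegral_indicator measurableSet_Iic]
    congr 1
    ext r
    by_cases hr : r ∈ Iic t <;> simp [hr]
  refine ⟨y, hy' _ seqContinuous_id, fun φ hφ s hs => ?_⟩
  have hc := hT.continuous_functional hφ x
  have hi (a b : ℝ) := hc.intervalIntegrable (μ := volume) a b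
  have h1 : φ (onReal T s y) = ∫ r in s..(s + t), φ (onReal T r x) := by
    rw [hy' _ (hT.seqContinuous s) φ hφ,
      ← add_zero s, add_assoc, zero_add,
      ← intervalIntegral.integral_comp_add_left (fun r => φ (onReal T r x)) s]
    refine intervalIntegral.integral_congr fun r hr => ?_
    rw [uIcc_of_le ht] at hr
    simp only [add_zero, hT.onReal_add hs hr.1]
  have h2 : (∫ r in (0 : ℝ)..s, φ (onReal T r (onReal T t x)))
      = ∫ r in t..(t + s), φ (onReal T r x) := by
    rw [← add_zero t, add_assoc, zero_add,
      ← intervalIntegral.integral_comp_add_left (fun r => φ (onReal T r x)) t]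
    refine intervalIntegral.integral_congr fun r hr => ?_
    rw [uIcc_of_le hs] at hr
    simp only [add_zero, add_comm t r, hT.onReal_add hr.1 ht]
  simp only [map_sub]
  rw [intervalIntegral.integral_sub ((hT.continuous_functional hφ _).intervalIntegrable _ _)
    (hi _ _), h2, h1, show φ y = _ from hy' _ seqContinuous_id φ hφ]
  have e1 := intervalIntegral.integral_add_adjacent_intervals (hi 0 s) (hi s (s + t))
  have e2 := intervalIntegral.integral_add_adjacent_intervals (hi 0 t) (hi t (t + s))
  rw [add_comm t s] at *
  simp only [ContinuousLinearMap.id_apply]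
  linear_combination e1 - e2

end Orbits

/-! ### The Laplace transform of a bi-continuous semigroup -/

section Laplace

open MeasureTheory Set

theorem exp_neg_mul_mul_exp (s α t : ℝ) :
    Real.exp (-s * t) * Real.exp (α * t) = Real.exp ((α - s) * t) := by
  rw [← Real.exp_add]
  ring_nf

theorem norm_exp_smul_le {s α c t : ℝ} {z : ℂ} (hz : ‖z‖ ≤ c * Real.exp (α * t)) :
    ‖Real.exp (-s * t) • z‖ ≤ c * Real.exp ((α - s) * t) := by
  rw [norm_smul, Real.norm_of_nonneg (Real.exp_pos _).le, ← exp_neg_mul_mul_exp, mul_left_comm]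
  gcongr

theorem integrableOn_exp_smul {u : ℝ → ℂ} (hu : Continuous u) {c α s : ℝ} (hs : α < s)
    (hc : ∀ t, 0 < t → ‖u t‖ ≤ c * Real.exp (α * t)) :
    IntegrableOn (fun t => Real.exp (-s * t) • u t) (Ioi 0) := by
  refine ((integrableOn_exp_mul_Ioi (sub_neg.2 hs) 0).const_mul c).mono'
    (Continuous.aestronglyMeasurable (by fun_prop)) ?_
  filter_upwards [ae_restrict_mem measurableSet_Ioi] with t ht
  exact norm_exp_smul_le (hc t ht)

theorem norm_integral_exp_smul_le {u : ℝ → ℂ} {c α s : ℝ} (hs : α < s)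
    (hc : ∀ t, 0 < t → ‖u t‖ ≤ c * Real.exp (α * t)) :
    ‖∫ t in Ioi (0 : ℝ), Real.exp (-s * t) • u t‖ ≤ c / (s - α) := by
  have h1 := norm_integral_le_of_norm_le (μ := volume.restrict (Ioi (0 : ℝ)))
    (f := fun t => Real.exp (-s * t) • u t)
    ((integrableOn_exp_mul_Ioi (sub_neg.2 hs) 0).const_mul c) (by
      filter_upwards [ae_restrict_mem measurableSet_Ioi] with t ht
      exact norm_exp_smul_le (hc t ht))
  refine h1.trans (le_of_eq ?_)
  rw [integral_const_mul, integral_exp_mul_Ioi (sub_neg.2 hs), mul_zero, Real.exp_zero, neg_div,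
    ← div_neg, neg_sub, mul_one_div]

theorem integral_Ioi_comp_add_left (g : ℝ → ℂ) (t : ℝ) :
    ∫ r in Ioi (0 : ℝ), g (t + r) = ∫ r in Ioi t, g r := by
  have h := (measurePreserving_add_left volume t).setIntegral_preimage_emb
    (measurableEmbedding_addLeft t) g (Ioi t)
  simpa using h

variable {τ : CoarseTopology E} {T : ℝ≥0 → E →L[ℂ] E} {M ω s : ℝ} {Q : E →L[ℂ] E}

/-- `Q` is the (weak) Laplace transform of `T` at `s`. -/
def IsLaplace (τ : CoarseTopology E) (T : ℝ≥0 → E →L[ℂ] E) (s : ℝ) (Q : E →L[ℂ] E) : Prop :=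
  ∀ S, SeqContinuous τ S → ∀ φ, τ.IsFunctional φ → ∀ x,
    φ (S (Q x)) = ∫ t in Ioi (0 : ℝ), Real.exp (-s * t) • φ (S (onReal T t x))

theorem HasType.norm_functional_le (h : HasType T M ω) (φ : E →L[ℂ] ℂ) (x : E) {t : ℝ}
    (ht : 0 ≤ t) : ‖φ (onReal T t x)‖ ≤ ‖φ‖ * M * ‖x‖ * Real.exp (ω * t) :=
  (φ.le_opNorm_of_le (h.norm_onReal_le ht x)).trans (le_of_eq (by ring))

theorem IsLaplace.apply (hQ : IsLaplace τ T s Q) {φ : E →L[ℂ] ℂ} (hφ : τ.IsFunctional φ) (x : E) :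
    φ (Q x) = ∫ t in Ioi (0 : ℝ), Real.exp (-s * t) • φ (onReal T t x) :=
  hQ _ seqContinuous_id φ hφ x

namespace IsBiContinuousSemigroup

variable (hT : IsBiContinuousSemigroup τ T)

include hT

theorem integrableOn_laplace (h : HasType T M ω) (hs : ω < s) {φ : E →L[ℂ] ℂ}
    (hφ : τ.IsFunctional φ) (x : E) :
    IntegrableOn (fun t => Real.exp (-s * t) • φ (onReal T t x)) (Ioi 0) :=
  integrableOn_exp_smul (hT.continuous_functional hφ x) hs
    fun _ ht => h.norm_functional_le φ x (le_of_lt ht)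

theorem exists_laplace [CompleteSpace E] (h : HasType T M ω) (hs : ω < s) :
    ∃ Q, IsLaplace τ T s Q := by
  choose Q hQ using hT.exists_weakIntegral h (w := fun t => Real.exp (-s * t)) (by
    simp only [exp_neg_mul_mul_exp]
    exact integrableOn_exp_mul_Ioi (sub_neg.2 hs) 0)
  have hQ1 (x : E) (φ : E →L[ℂ] ℂ) (hφ : τ.IsFunctional φ) :
      φ (Q x) = ∫ t in Ioi (0 : ℝ), Real.exp (-s * t) • φ (onReal T t x) :=
    hQ x _ seqContinuous_id φ hφ
  let L : E →ₗ[ℂ] E :=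
    { toFun := Q
      map_add' := fun x y => CoarseTopology.eq_of_forall_functional (τ := τ) fun φ hφ => by
        rw [φ.map_add, hQ1 _ φ hφ, hQ1 _ φ hφ, hQ1 _ φ hφ,
          ← integral_add (hT.integrableOn_laplace h hs hφ x) (hT.integrableOn_laplace h hs hφ y)]
        simp only [_root_.map_add, smul_add]
      map_smul' := fun c x => CoarseTopology.eq_of_forall_functional (τ := τ) fun φ hφ => by
        rw [RingHom.id_apply, map_smul, hQ1 _ φ hφ, hQ1 _ φ hφ, ← integral_smul]
        simp only [map_smul, smul_comm c] }
  refine ⟨L.mkContinuous (M / (s - ω)) fun x => ?_, fun S hS φ hφ x => hQ x S hS φ hφ⟩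
  refine CoarseTopology.norm_le_of_forall_functional (τ := τ) fun φ hφ h1 => ?_
  change ‖φ (Q x)‖ ≤ _
  rw [hQ1 x φ hφ, div_mul_eq_mul_div]
  refine norm_integral_exp_smul_le hs fun t ht => (h.norm_functional_le φ x ht.le).trans ?_
  have := h.nonneg
  gcongr
  exact mul_le_of_le_one_left this h1

end IsBiContinuousSemigroup

namespace IsLaplace

variable (hT : IsBiContinuousSemigroup τ T) (h : HasType T M ω) (hs : ω < s)
  (hQ : IsLaplace τ T s Q)

include hT hQ

/-- The bound is imposed on the whole orbit so that `Q x` satisfies one of the same form, with a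
smaller or larger constant c/(s-α). It can therefore be iterated, and no formula for powers of the
resolvent is needed. -/
theorem seminorm_le {p : Seminorm ℂ E} (hp : τ.IsSeminorm p) {α c : ℝ} (hα : α < s) {x : E}
    (hx : ∀ r, 0 ≤ r → p (onReal T r x) ≤ c * Real.exp (α * r)) :
    ∀ r, 0 ≤ r → p (onReal T r (Q x)) ≤ c / (s - α) * Real.exp (α * r) := by
  intro r hr
  obtain ⟨φ, hφ, hφp, hφx⟩ := CoarseTopology.exists_functional hp (onReal T r (Q x))
  rw [← hφx, hQ _ (hT.seqContinuous r) φ hφ, div_mul_eq_mul_div]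
  refine norm_integral_exp_smul_le hα fun t ht => (hφp _).trans ?_
  rw [← hT.onReal_add hr ht.le, mul_assoc, ← Real.exp_add, ← mul_add]
  exact hx _ (by positivity)

theorem seminorm_pow_le {p : Seminorm ℂ E} (hp : τ.IsSeminorm p) {α c : ℝ} (hα : α < s) {x : E}
    (hx : ∀ r, 0 ≤ r → p (onReal T r x) ≤ c * Real.exp (α * r)) (k : ℕ) :
    ∀ r, 0 ≤ r → p (onReal T r ((Q ^ k) x)) ≤ c / (s - α) ^ k * Real.exp (α * r) := by
  induction k with
  | zero => simpa using hx
  | succ k ih =>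
    have := hQ.seminorm_le hT hp hα ih
    rw [pow_succ', pow_succ, ← div_div]
    exact this

include h hs

/-- The substitution r ↦ t + r in the Laplace integral. The right-hand side is differentiable in t
although `T` is not. -/
theorem map_onReal {t : ℝ} (ht : 0 ≤ t) {φ : E →L[ℂ] ℂ} (hφ : τ.IsFunctional φ) (x : E) :
    φ (onReal T t (Q x)) = Real.exp (s * t) •
      (φ (Q x) - ∫ r in (0 : ℝ)..t, Real.exp (-s * r) • φ (onReal T r x)) := by
  have hi := hT.integrableOn_laplace h hs hφ x
  rw [hQ _ (hT.seqContinuous t) φ hφ, hQ.apply hφ,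
    ← intervalIntegral.integral_interval_add_Ioi hi (hi.mono_set (Ioi_subset_Ioi ht)),
    add_sub_cancel_left, ← integral_Ioi_comp_add_left _ t,
    ← integral_smul (Real.exp (s * t))
      (fun r => Real.exp (-s * (t + r)) • φ (onReal T (t + r) x))]
  refine setIntegral_congr_fun measurableSet_Ioi fun r (hr : 0 < r) => ?_
  simp only [hT.onReal_add ht hr.le, smul_smul, ← Real.exp_add]
  ring_nf

/-- By `map_onReal`, v(t) = φ(T(t)Qx) solves v' = sv - φ(T(t)x); integrating this is the claim. -/
theorem intRel (x : E) : IntRel τ T (Q x) ((s : ℂ) • Q x - x) := by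
  intro φ hφ t ht
  have hu := hT.continuous_functional hφ x
  set e : ℝ → ℂ := fun r => Real.exp (-s * r) • φ (onReal T r x) with he
  have hec : Continuous e := (Real.continuous_exp.comp (continuous_const_mul (-s))).smul hu
  set v : ℝ → ℂ := fun t => Real.exp (s * t) • (φ (Q x) - ∫ r in (0 : ℝ)..t, e r) with hv
  have hd (t : ℝ) : HasDerivAt v (s • v t - φ (onReal T t x)) t := by
    have h1 : HasDerivAt (fun t => φ (Q x) - ∫ r in (0 : ℝ)..t, e r) (-(e t)) t :=
      (intervalIntegral.integral_hasDerivAt_right (hec.intervalIntegrable _ _)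
        (hec.stronglyMeasurableAtFilter _ _) hec.continuousAt).const_sub _
    have h2 : HasDerivAt (fun t => Real.exp (s * t)) (Real.exp (s * t) * s) t := by
      simpa using ((hasDerivAt_id t).const_mul s).exp
    refine (h2.smul h1).congr_deriv ?_
    simp only [hv, he, smul_smul, smul_neg, ← Real.exp_add]
    rw [mul_comm (Real.exp (s * t)) s, show s * t + -s * t = 0 by ring, Real.exp_zero, one_smul]
    abel
  have hvc : Continuous v := continuous_iff_continuousAt.2 fun t => (hd t).continuousAt
  have hvt (r : ℝ) (hr : 0 ≤ r) : φ (onReal T r (Q x)) = v r := hQ.map_onReal hT h hs hr hφ x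
  rw [hvt t ht, show φ (Q x) = v 0 by simp [hv],
    ← intervalIntegral.integral_eq_sub_of_hasDerivAt (fun r _ => hd r)
      ((hvc.const_smul s).sub hu |>.intervalIntegrable _ _)]
  refine intervalIntegral.integral_congr fun r hr => ?_
  rw [uIcc_of_le ht] at hr
  simp [hvt r hr.1]

/-- The Laplace integrand of sx - y is minus the derivative of e^{-st}φ(T(t)x), which vanishes at
infinity because s > ω; only the boundary term φ(x) at 0 remains. -/
theorem apply_of_intRel {x y : E} (hxy : IntRel τ T x y) : Q ((s : ℂ) • x - y) = x := by
  refine CoarseTopology.eq_of_forall_functional (τ := τ) fun φ hφ => ?_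
  have hu := hT.continuous_functional hφ y
  -- This agrees with φ(T(t)x) for t ≥ 0 and, unlike `onReal`, is differentiable across 0.
  set v : ℝ → ℂ := fun t => φ x + ∫ r in (0 : ℝ)..t, φ (onReal T r y) with hv
  have hd (t : ℝ) : HasDerivAt v (φ (onReal T t y)) t :=
    (intervalIntegral.integral_hasDerivAt_right (hu.intervalIntegrable _ _)
      (hu.stronglyMeasurableAtFilter _ _) hu.continuousAt).const_add _
  have hvt (r : ℝ) (hr : 0 ≤ r) : φ (onReal T r x) = v r := by
    simp only [hv]
    rw [← hxy φ hφ r hr]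
    ring
  have hd2 (t : ℝ) : HasDerivAt (fun t => Real.exp (-s * t) • v t)
      (-(Real.exp (-s * t) • (s • v t - φ (onReal T t y)))) t := by
    have h2 : HasDerivAt (fun t => Real.exp (-s * t)) (Real.exp (-s * t) * -s) t := by
      simpa using ((hasDerivAt_id t).const_mul (-s)).exp
    refine (h2.smul (hd t)).congr_deriv ?_
    module
  have heq : EqOn (fun t => Real.exp (-s * t) • φ (onReal T t ((s : ℂ) • x - y)))
      (fun t => Real.exp (-s * t) • (s • v t - φ (onReal T t y))) (Ioi 0) := by
    intro t ht
    simp [hvt t (le_of_lt ht)]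
  have hi := (hT.integrableOn_laplace h hs hφ ((s : ℂ) • x - y)).congr_fun heq measurableSet_Ioi
  have hlim : Tendsto (fun t => Real.exp (-s * t) • v t) atTop (𝓝 0) := by
    have h0 : Tendsto (fun t => ‖φ‖ * M * ‖x‖ * Real.exp ((ω - s) * t)) atTop (𝓝 0) := by
      have : Tendsto (fun t : ℝ => (ω - s) * t) atTop atBot :=
        tendsto_id.const_mul_atTop_of_neg (sub_neg.2 hs)
      simpa using (Real.tendsto_exp_atBot.comp this).const_mul (‖φ‖ * M * ‖x‖)
    refine squeeze_zero_norm' ?_ h0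
    filter_upwards [eventually_ge_atTop 0] with t ht
    refine norm_exp_smul_le ?_
    rw [← hvt t ht]
    exact h.norm_functional_le φ x ht
  have hfin := integral_Ioi_of_hasDerivAt_of_tendsto' (fun t _ => hd2 t) hi.neg hlim
  rw [hQ.apply hφ, setIntegral_congr_fun measurableSet_Ioi heq]
  rw [integral_neg] at hfin
  simpa [hv] using hfin

theorem norm_pow_le (k : ℕ) : ‖Q ^ k‖ ≤ M / (s - ω) ^ k := by
  have hM := h.nonneg
  have hsω : 0 < s - ω := sub_pos.2 hs
  refine ContinuousLinearMap.opNorm_le_bound _ (by positivity) fun x => ?_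
  refine CoarseTopology.norm_le_of_forall_functional (τ := τ) fun φ hφ h1 => ?_
  have h2 := hQ.seminorm_pow_le hT hφ.isSeminorm hs (c := M * ‖x‖) (x := x) (fun r hr => by
    refine (h.norm_functional_le φ x hr).trans ?_
    gcongr
    exact mul_le_of_le_one_left hM h1) k 0 le_rfl
  simpa [hT.onReal_zero, div_mul_eq_mul_div] using h2

end IsLaplace

/-- Local bi-equicontinuity becomes global under the weight e^{αr}, α > ω: past some r₀ the norm
growth alone is below ε e^{αr} for every n, and on [0, r₀] the local property applies. -/
theorem IsBiContinuousSemigroup.eventually_seminorm_le (hT : IsBiContinuousSemigroup τ T)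
    (h : HasType T M ω) {α : ℝ} (hα : ω < α) {u : ℕ → E} (hb : ∃ C : ℝ, ∀ n, ‖u n‖ ≤ C)
    (hu : Tendsto u atTop (τ.nhds 0)) {p : Seminorm ℂ E} (hp : τ.IsSeminorm p) {ε : ℝ}
    (hε : 0 < ε) :
    ∀ᶠ n in atTop, ∀ r, 0 ≤ r → p (onReal T r (u n)) ≤ ε * Real.exp (α * r) := by
  have hM := h.nonneg
  obtain ⟨C, hC⟩ := id hb
  obtain ⟨D, hD, hpD⟩ := hp.exists_bound
  have h0 : Tendsto (fun t => D * (M * C) * Real.exp ((ω - α) * t)) atTop (𝓝 0) := by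
    have : Tendsto (fun t : ℝ => (ω - α) * t) atTop atBot :=
      tendsto_id.const_mul_atTop_of_neg (sub_neg.2 hα)
    simpa using (Real.tendsto_exp_atBot.comp this).const_mul (D * (M * C))
  obtain ⟨r₀, hr₀⟩ := eventually_atTop.1 (h0.eventually_le_const hε)
  filter_upwards [biEquicontinuous_iff.1 (hT.locally_biequicontinuous r₀.toNNReal) u hb hu p hp
    -- On [0, r₀] the weight e^{αr} is at least e^{-|α|r₀}.
    (ε * Real.exp (-(|α| * r₀))) (by positivity)] with n hn r hr
  rcases le_total r₀ r with hr' | hr'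
  · calc p (onReal T r (u n)) ≤ D * (M * Real.exp (ω * r) * C) := by
          refine (hpD _).trans ?_
          gcongr
          refine (h.norm_onReal_le hr _).trans ?_
          gcongr
          exact hC n
      _ = D * (M * C) * Real.exp ((ω - α) * r) * Real.exp (α * r) := by
          rw [mul_assoc _ (Real.exp _) (Real.exp _), ← Real.exp_add]
          ring_nf
      _ ≤ _ := by
          gcongr
          exact hr₀ r hr'
  · refine (hn ⟨r.toNNReal, Real.toNNReal_le_toNNReal hr'⟩).le.trans ?_
    gcongr
    rw [neg_le_iff_add_nonneg]
    have h1 : -(|α| * r) ≤ α * r := by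
      rw [← neg_mul]
      gcongr
      exact neg_abs_le α
    have h2 : |α| * r ≤ |α| * r₀ := by gcongr
    linarith

/-! ### Necessity: resolvent bounds, bi-equicontinuity and bi-density for a generator. -/

variable {A : E →ₗ.[ℂ] E}

theorem IsBiGenerator.mem_graph_iff (hA : IsBiGenerator τ T A) (hT : IsBiContinuousSemigroup τ T)
    {x y : E} : (x, y) ∈ A.graph ↔ IntRel τ T x y :=
  (hA x y).trans (genRel_iff_intRel hT)

theorem IsLaplace.isResolventAt (hQ : IsLaplace τ T s Q) (hT : IsBiContinuousSemigroup τ T)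
    (h : HasType T M ω) (hA : IsBiGenerator τ T A) (hs : ω < s) : IsResolventAt A s Q := by
  refine ⟨fun x => ?_, fun x => ?_⟩
  · have h1 := (hA.mem_graph_iff hT).2 (hQ.intRel hT h hs x)
    obtain ⟨y, hy, hy2⟩ := (LinearPMap.mem_graph_iff _).1 h1
    obtain ⟨y, hyd⟩ := y
    simp only at hy hy2
    subst hy
    exact ⟨hyd, by rw [hy2]; abel⟩
  · exact hQ.apply_of_intRel hT h hs ((hA.mem_graph_iff hT).1 (A.mem_graph x))

theorem IsBiGenerator.isLaplace_resolvent [CompleteSpace E] (hA : IsBiGenerator τ T A)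
    (hT : IsBiContinuousSemigroup τ T) (h : HasType T M ω) (hs : ω < s) :
    (s : ℂ) ∈ resolventSet A ∧ IsLaplace τ T s (resolvent A s) := by
  obtain ⟨Q, hQ⟩ := hT.exists_laplace h hs
  have h1 := hQ.isResolventAt hT h hA hs
  have h2 : (s : ℂ) ∈ resolventSet A := ⟨Q, h1⟩
  exact ⟨h2, (isResolventAt_resolvent h2).unique h1 ▸ hQ⟩

theorem IsBiGenerator.isHilleYosida [CompleteSpace E] (hA : IsBiGenerator τ T A)
    (hT : IsBiContinuousSemigroup τ T) (h : HasType T M ω) : IsHilleYosida A M ω := fun _ hs =>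
  ⟨(hA.isLaplace_resolvent hT h hs).1, (hA.isLaplace_resolvent hT h hs).2.norm_pow_le hT h hs⟩

theorem IsBiGenerator.biEquicontinuous_resolvent [CompleteSpace E] (hA : IsBiGenerator τ T A)
    (hT : IsBiContinuousSemigroup τ T) (h : HasType T M ω) {α : ℝ} (hα : ω < α) :
    BiEquicontinuous τ (fun i : ℕ × Set.Ici α =>
      ((((i.2 : ℝ) - α : ℝ) : ℂ) ^ i.1) • resolvent A ((i.2 : ℝ) : ℂ) ^ i.1) := by
  rw [biEquicontinuous_iff]
  intro u hb hu p hp ε hε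
  filter_upwards [hT.eventually_seminorm_le h hα hb hu hp (half_pos hε)] with n hn
  rintro ⟨k, s, hs⟩
  have hs' : α ≤ s := hs
  simp only [smul_apply, map_smul_eq_mul, norm_pow, Complex.norm_real,
    Real.norm_of_nonneg (sub_nonneg.2 hs')]
  -- The Laplace estimate needs α < s. At s = α the factor is 0^k, so the operator is the identity
  -- for k = 0 and zero otherwise.
  rcases hs'.eq_or_lt with rfl | hlt
  · rcases k with _ | k
    · have := hn 0 le_rfl
      simp only [hT.onReal_zero, mul_zero, Real.exp_zero, mul_one,
        ContinuousLinearMap.id_apply] at this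
      simpa using this.trans_lt (half_lt_self hε)
    · simpa using hε
  · have h1 := (hA.isLaplace_resolvent hT h (hα.trans_le hs')).2.seminorm_pow_le hT hp hlt hn k 0 le_rfl
    simp only [hT.onReal_zero, mul_zero, Real.exp_zero, mul_one,
      ContinuousLinearMap.id_apply] at h1
    have h2 : 0 < (s - α) ^ k := pow_pos (sub_pos.2 hlt) k
    rw [le_div_iff₀ h2, mul_comm] at h1
    exact h1.trans_lt (half_lt_self hε)

/-- Approximation of `x` by the time averages of its orbit. -/
theorem IsBiGenerator.exists_mem_domain [CompleteSpace E] (hA : IsBiGenerator τ T A)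
    (hT : IsBiContinuousSemigroup τ T) (x : E) {t : ℝ} (ht : 0 < t) :
    ∃ y ∈ A.domain, (∀ c, (∀ r, 0 < r → r ≤ t → ‖onReal T r x - x‖ ≤ c) → ‖y - x‖ ≤ c) ∧
      ∀ p, τ.IsSeminorm p → ∀ c, (∀ r, 0 < r → r ≤ t → p (onReal T r x - x) ≤ c) →
        p (y - x) ≤ c := by
  obtain ⟨y, hy, hxy⟩ := exists_average hT x ht.le
  have hne : (t : ℂ) ≠ 0 := by exact_mod_cast ht.ne'
  have hw (φ : E →L[ℂ] ℂ) (hφ : τ.IsFunctional φ) :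
      φ (y - (t : ℂ) • x) = ∫ r in (0 : ℝ)..t, φ (onReal T r x - x) := by
    simp only [map_sub]
    rw [hy φ hφ, intervalIntegral.integral_sub
      ((hT.continuous_functional hφ x).intervalIntegrable _ _) intervalIntegrable_const]
    simp
  have he : (t : ℂ)⁻¹ • y - x = (t : ℂ)⁻¹ • (y - (t : ℂ) • x) := by
    rw [smul_sub, smul_smul, inv_mul_cancel₀ hne, one_smul]
  refine ⟨(t : ℂ)⁻¹ • y, A.domain.smul_mem _ ?_, fun c hc => ?_, fun p hp c hc => ?_⟩
  · exact LinearPMap.mem_domain_of_mem_graph ((hA.mem_graph_iff hT).2 hxy)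
  · rw [he, norm_smul, norm_inv, Complex.norm_real, Real.norm_of_nonneg ht.le,
      inv_mul_le_iff₀ ht, mul_comm]
    exact norm_le_of_weakIntegral ht.le hw hc
  · rw [he, map_smul_eq_mul, norm_inv, Complex.norm_real, Real.norm_of_nonneg ht.le,
      inv_mul_le_iff₀ ht, mul_comm]
    exact seminorm_le_of_weakIntegral hp ht.le hw hc

theorem IsBiGenerator.isBiDenselyDefined [CompleteSpace E] (hA : IsBiGenerator τ T A)
    (hT : IsBiContinuousSemigroup τ T) : IsBiDenselyDefined τ A := by
  intro x
  obtain ⟨M, ω, hM, h⟩ := hT.exponentially_bounded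
  have hpos (n : ℕ) : (0 : ℝ) < 1 / ((n : ℝ) + 1) := Nat.one_div_pos_of_nat
  choose u hu hun hup using fun n : ℕ => hA.exists_mem_domain hT x (hpos n)
  refine ⟨u, hu, ⟨(M * Real.exp (|ω| * 1) * ‖x‖ + ‖x‖) + ‖x‖, fun n => ?_⟩, ?_⟩
  · have h1 := hun n _ fun r hr hr' => (norm_sub_le _ _).trans
      (add_le_add_left (h.norm_onReal_le_of_le hr.le
        (hr'.trans ((div_le_one (by positivity)).2 (by linarith [n.cast_nonneg (α := ℝ)]))) x) _)
    calc ‖u n‖ = ‖(u n - x) + x‖ := by simp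
      _ ≤ _ := (norm_add_le _ _).trans (add_le_add_left h1 _)
  · refine CoarseTopology.tendsto_iff.2 fun p hp => ?_
    rw [Metric.tendsto_nhds]
    intro ε hε
    have h1 := CoarseTopology.tendsto_iff.1 (hT.tendsto_onReal x 0) p hp
    simp only [hT.onReal_zero, ContinuousLinearMap.id_apply] at h1
    obtain ⟨δ, hδ, hb⟩ := Metric.eventually_nhds_iff.1 (h1.eventually_lt_const (half_pos hε))
    filter_upwards [(tendsto_one_div_add_atTop_nhds_zero_nat (𝕜 := ℝ)).eventually_lt_const hδ]
      with n hn
    rw [Real.dist_eq, sub_zero, abs_of_nonneg (apply_nonneg p _)]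
    refine (hup n p hp (ε / 2) fun r hr hrt => (hb ?_).le).trans_lt (half_lt_self hε)
    rw [Real.dist_eq, sub_zero, abs_of_pos hr]
    linarith

end Laplace

/-! ### Implicit Euler steps of a Hille–Yosida operator -/

section Euler

/-- Source of the stability constant e^{2αb}: for hα ≤ 1/2 and kh ≤ b it bounds (1 - hα)^{-k}. -/
theorem exp_neg_two_mul_le {x : ℝ} (h0 : 0 ≤ x) (h1 : x ≤ 1 / 2) : Real.exp (-(2 * x)) ≤ 1 - x := by
  rw [Real.exp_neg]
  refine inv_le_of_inv_le₀ (by linarith) ?_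
  refine le_trans ?_ (Real.add_one_le_exp (2 * x))
  rw [inv_le_iff_one_le_mul₀ (by linarith)]
  nlinarith

theorem norm_one_le_clm : ‖(1 : E →L[ℂ] E)‖ ≤ 1 := ContinuousLinearMap.norm_id_le

/-- Telescoping, P^n - Q^n = ∑ P^i Q^{n-1-i}(P - Q). The n-step error is at most n times the
one-step error, provided all mixed powers share a bound. -/
theorem norm_pow_sub_pow_le {P Q : E →L[ℂ] E} (hPQ : Commute P Q) {n : ℕ} {K : ℝ}
    (hK : ∀ i j, i ≤ n → j ≤ n → ∀ z, ‖(P ^ i) ((Q ^ j) z)‖ ≤ K * ‖z‖) (x : E) :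
    ‖(P ^ n) x - (Q ^ n) x‖ ≤ n * (K * ‖P x - Q x‖) := by
  have h := (hPQ.geom_sum₂_mul n)
  have h2 : (P ^ n) x - (Q ^ n) x =
      ∑ i ∈ Finset.range n, (P ^ i) ((Q ^ (n - 1 - i)) (P x - Q x)) := by
    rw [← sub_apply, ← h]
    simp [mul_sub, sub_apply]
  rw [h2]
  refine (norm_sum_le_of_le _ fun i hi => hK i (n - 1 - i) ?_ (by omega) _).trans (by simp)
  exact (Finset.mem_range.1 hi).le

variable {A : E →ₗ.[ℂ] E}

theorem IsResolventAt.mem_graph {z : ℂ} {R : E →L[ℂ] E} (hR : IsResolventAt A z R) (x : E) :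
    (R x, z • R x - x) ∈ A.graph := by
  obtain ⟨h, hx⟩ := hR.1 x
  rw [LinearPMap.mem_graph_iff]
  refine ⟨⟨R x, h⟩, rfl, ?_⟩
  simp only
  rw [eq_sub_iff_add_eq, add_comm, ← eq_sub_iff_add_eq]
  exact hx.symm

theorem IsResolventAt.apply_of_mem_graph {z : ℂ} {R : E →L[ℂ] E} (hR : IsResolventAt A z R)
    {x y : E} (h : (x, y) ∈ A.graph) : R (z • x - y) = x := by
  obtain ⟨w, hw, hw2⟩ := (LinearPMap.mem_graph_iff _).1 h
  simp only at hw hw2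
  rw [← hw, ← hw2]
  exact hR.2 w

theorem IsResolventAt.sub_eq {z w : ℂ} {R S : E →L[ℂ] E} (hR : IsResolventAt A z R)
    (hS : IsResolventAt A w S) (x : E) : S x - R x = (z - w) • R (S x) := by
  have h := hR.apply_of_mem_graph (hS.mem_graph x)
  rw [show z • S x - (w • S x - x) = (z - w) • S x + x by module, map_add, map_smul] at h
  exact sub_eq_of_eq_add h.symm

theorem IsResolventAt.commute {z w : ℂ} {R S : E →L[ℂ] E} (hR : IsResolventAt A z R)
    (hS : IsResolventAt A w S) : Commute R S := by
  rcases eq_or_ne z w with rfl | hne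
  · rw [hR.unique hS]
  · ext x
    have h1 := hR.sub_eq hS x
    have h2 := hS.sub_eq hR x
    have h3 : (z - w) • (R (S x) - S (R x)) = 0 := by
      rw [smul_sub, ← h1, show (z - w) • S (R x) = -((w - z) • S (R x)) by module, ← h2]
      abel
    exact sub_eq_zero.1 ((smul_eq_zero.1 h3).resolve_left (sub_ne_zero.2 hne))

open Classical in
/-- The implicit Euler step `(1 - hA)⁻¹`. -/
def eulerStep (A : E →ₗ.[ℂ] E) (h : ℝ) : E →L[ℂ] E :=
  if h = 0 then 1 else ((h⁻¹ : ℝ) : ℂ) • resolvent A ((h⁻¹ : ℝ) : ℂ)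

/-- The value at step length 0 lets t = 0, and t / n with n = 0, obey the general formulas. -/
theorem eulerStep_zero : eulerStep A 0 = 1 := if_pos rfl

theorem eulerStep_of_ne {h : ℝ} (hh : h ≠ 0) :
    eulerStep A h = ((h⁻¹ : ℝ) : ℂ) • resolvent A ((h⁻¹ : ℝ) : ℂ) := if_neg hh

variable {M ω α : ℝ}

theorem IsHilleYosida.isResolventAt (hA : IsHilleYosida A M ω) {h : ℝ} (h0 : 0 < h)
    (h1 : ω * h < 1) : IsResolventAt A ((h⁻¹ : ℝ) : ℂ) (resolvent A ((h⁻¹ : ℝ) : ℂ)) :=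
  isResolventAt_resolvent (hA _ (by rwa [← one_div, lt_div_iff₀ h0])).1

theorem IsHilleYosida.norm_eulerStep_pow_le (hA : IsHilleYosida A M ω) (hM : 1 ≤ M) {h : ℝ}
    (h0 : 0 ≤ h) (h1 : ω * h < 1) (k : ℕ) : ‖eulerStep A h ^ k‖ ≤ M / (1 - ω * h) ^ k := by
  rcases h0.eq_or_lt with rfl | h0
  · simpa [eulerStep_zero] using (norm_one_le_clm (E := E)).trans hM
  · have h2 : ω < h⁻¹ := by rwa [← one_div, lt_div_iff₀ h0]
    rw [eulerStep_of_ne h0.ne', smul_pow, norm_smul, norm_pow, Complex.norm_real,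
      Real.norm_of_nonneg (inv_nonneg.2 h0.le)]
    calc h⁻¹ ^ k * ‖resolvent A ((h⁻¹ : ℝ) : ℂ) ^ k‖ ≤ h⁻¹ ^ k * (M / (h⁻¹ - ω) ^ k) := by
          gcongr
          exact (hA _ h2).2 k
      _ = M / (1 - ω * h) ^ k := by
          have h3 : h⁻¹ - ω = h⁻¹ * (1 - ω * h) := by field_simp
          have h4 : h⁻¹ ^ k ≠ 0 := pow_ne_zero _ (inv_ne_zero h0.ne')
          rw [h3, mul_pow, ← div_div, mul_div_assoc', mul_div_assoc', mul_comm (h⁻¹ ^ k) M,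
            mul_div_cancel_right₀ _ h4]

theorem exp_neg_le_one_sub_pow (hα0 : 0 ≤ α) {h b : ℝ} {k : ℕ} (h0 : 0 ≤ h) (h1 : h * α ≤ 1 / 2)
    (hb : k * h ≤ b) : Real.exp (-(2 * α * b)) ≤ (1 - h * α) ^ k := by
  have h2 := pow_le_pow_left₀ (Real.exp_pos _).le (exp_neg_two_mul_le (by positivity) h1) k
  rw [← Real.exp_nat_mul] at h2
  refine le_trans (Real.exp_le_exp.2 ?_) h2
  nlinarith

theorem IsHilleYosida.norm_eulerStep_pow_apply_le (hA : IsHilleYosida A M ω) (hM : 1 ≤ M)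
    (hα : ω < α) (hα0 : 0 < α) {h b : ℝ} {k : ℕ} (h0 : 0 ≤ h) (h1 : h * α ≤ 1 / 2)
    (hb : k * h ≤ b) (x : E) :
    ‖(eulerStep A h ^ k) x‖ ≤ M * Real.exp (2 * α * b) * ‖x‖ := by
  have h2 : ω * h ≤ h * α := by nlinarith
  refine ContinuousLinearMap.le_of_opNorm_le _ ((hA.norm_eulerStep_pow_le hM h0 (by linarith) k).trans
    ?_) x
  rw [div_eq_mul_inv]
  gcongr
  rw [inv_le_comm₀ (pow_pos (by linarith) k) (Real.exp_pos _), ← Real.exp_neg]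
  refine (exp_neg_le_one_sub_pow hα0.le h0 h1 hb).trans ?_
  gcongr
  linarith

/-! ### Consistency of Euler steps on D(A) and D(A²). -/

section Step

variable (hA : IsHilleYosida A M ω) {h : ℝ} (h0 : 0 ≤ h) (h1 : ω * h < 1)

include hA h0 h1

theorem IsHilleYosida.eulerStep_apply {x y : E} (hxy : (x, y) ∈ A.graph) :
    eulerStep A h x = x + (h : ℂ) • eulerStep A h y := by
  rcases h0.eq_or_lt with rfl | h0
  · simp [eulerStep_zero]
  · have h2 := (hA.isResolventAt h0 h1).apply_of_mem_graph hxy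
    have hne : (h : ℂ) ≠ 0 := by exact_mod_cast h0.ne'
    rw [map_sub, map_smul, sub_eq_iff_eq_add] at h2
    rw [eulerStep_of_ne h0.ne']
    simp only [smul_apply, smul_smul]
    rw [h2]
    push_cast
    rw [mul_inv_cancel₀ hne, one_smul]

theorem IsHilleYosida.eulerStep_mem_graph {x y : E} (hxy : (x, y) ∈ A.graph) :
    (eulerStep A h x, eulerStep A h y) ∈ A.graph := by
  rcases h0.eq_or_lt with rfl | h0
  · simpa [eulerStep_zero] using hxy
  · have h2 := (hA.isResolventAt h0 h1).apply_of_mem_graph hxy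
    have h3 := A.graph.smul_mem (((h⁻¹ : ℝ) : ℂ)) ((hA.isResolventAt h0 h1).mem_graph x)
    rw [eulerStep_of_ne h0.ne']
    convert! h3 using 1
    rw [map_sub, map_smul, sub_eq_iff_eq_add] at h2
    refine Prod.ext rfl ?_
    change ((h⁻¹ : ℝ) : ℂ) • resolvent A ((h⁻¹ : ℝ) : ℂ) y =
      ((h⁻¹ : ℝ) : ℂ) • (((h⁻¹ : ℝ) : ℂ) • resolvent A ((h⁻¹ : ℝ) : ℂ) x - x)
    rw [h2, add_sub_cancel_left]

theorem IsHilleYosida.eulerStep_pow_succ {x y : E} (hxy : (x, y) ∈ A.graph) (j : ℕ) :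
    (eulerStep A h ^ (j + 1)) x = (eulerStep A h ^ j) x + (h : ℂ) • (eulerStep A h ^ (j + 1)) y := by
  change (eulerStep A h ^ j) (eulerStep A h x) = _ + (h : ℂ) • (eulerStep A h ^ j) (eulerStep A h y)
  rw [hA.eulerStep_apply h0 h1 hxy, map_add, map_smul]

theorem IsHilleYosida.norm_eulerStep_pow_sub_le {y z : E} (hyz : (y, z) ∈ A.graph) {N : ℕ} {K : ℝ}
    (hK : ∀ j ≤ N, ‖(eulerStep A h ^ j) z‖ ≤ K) :
    ‖(eulerStep A h ^ N) y - y‖ ≤ K * (N * h) := by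
  induction N with
  | zero => simp
  | succ N ih =>
    rw [hA.eulerStep_pow_succ h0 h1 hyz, add_sub_right_comm]
    refine (norm_add_le_of_le (ih fun j hj => hK j (by omega)) (r₂ := h * K) ?_).trans ?_
    · rw [norm_smul, Complex.norm_real, Real.norm_of_nonneg h0]
      gcongr
      exact hK _ le_rfl
    · push_cast
      linarith

/-- Second-order consistency on D(A²): the error is the sum of the terms h(J^j y - y), each of first
order. General `N` is needed to compare one coarse step with N fine ones of the same total length.
-/
theorem IsHilleYosida.norm_eulerStep_pow_sub_sub_le {x y z : E} (hxy : (x, y) ∈ A.graph)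
    (hyz : (y, z) ∈ A.graph) {N : ℕ} {K : ℝ}
    (hK : ∀ j ≤ N, ‖(eulerStep A h ^ j) z‖ ≤ K) :
    ‖(eulerStep A h ^ N) x - x - ((N * h : ℝ) : ℂ) • y‖ ≤ K * (N * h) ^ 2 := by
  have hK0 : 0 ≤ K := (norm_nonneg _).trans (hK 0 (Nat.zero_le _))
  induction N with
  | zero => simp
  | succ N ih =>
    have e : (eulerStep A h ^ (N + 1)) x - x - (((N + 1 : ℕ) * h : ℝ) : ℂ) • y =
        ((eulerStep A h ^ N) x - x - ((N * h : ℝ) : ℂ) • y) +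
          (h : ℂ) • ((eulerStep A h ^ (N + 1)) y - y) := by
      rw [hA.eulerStep_pow_succ h0 h1 hxy]
      push_cast
      module
    rw [e]
    refine (norm_add_le_of_le (ih fun j hj => hK j (by omega))
      (r₂ := h * (K * ((N + 1 : ℕ) * h))) ?_).trans ?_
    · rw [norm_smul, Complex.norm_real, Real.norm_of_nonneg h0]
      gcongr
      exact hA.norm_eulerStep_pow_sub_le h0 h1 hyz hK
    · push_cast
      -- The induction closes because N² + (N + 1) ≤ (N + 1)², with surplus N.
      have : 0 ≤ K * h ^ 2 * N := by positivity
      nlinarith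

end Step

theorem IsHilleYosida.commute_eulerStep (hA : IsHilleYosida A M ω) {h k : ℝ} (h0 : 0 ≤ h)
    (h1 : ω * h < 1) (k0 : 0 ≤ k) (k1 : ω * k < 1) : Commute (eulerStep A h) (eulerStep A k) := by
  rcases h0.eq_or_lt with rfl | h0
  · rw [eulerStep_zero]
    exact Commute.one_left _
  rcases k0.eq_or_lt with rfl | k0
  · rw [eulerStep_zero]
    exact Commute.one_right _
  rw [eulerStep_of_ne h0.ne', eulerStep_of_ne k0.ne']
  exact (((hA.isResolventAt h0 h1).commute (hA.isResolventAt k0 k1)).smul_left _).smul_right _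

end Euler

/-! ### Approximation arguments for bi-equicontinuous families -/

section Approximation

variable {τ : CoarseTopology E}

theorem CoarseTopology.tendsto_of_approx {ι : Type*} {l : Filter ι} {S : ι → E →L[ℂ] E}
    {S' : E →L[ℂ] E} {u : ℕ → E} {x : E} (hS' : Tendsto (fun k => S' (u k)) atTop (τ.nhds (S' x)))
    (hS : ∀ p, τ.IsSeminorm p → ∀ ε > 0, ∀ᶠ k in atTop, ∀ᶠ i in l, p (S i (u k - x)) < ε)
    (hu : ∀ k, Tendsto (fun i => S i (u k)) l (τ.nhds (S' (u k)))) :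
    Tendsto (fun i => S i x) l (τ.nhds (S' x)) := by
  refine tendsto_iff.2 fun p hp => ?_
  rw [Metric.tendsto_nhds]
  intro ε hε
  have hε3 : 0 < ε / 3 := by positivity
  obtain ⟨k, hk1, hk2⟩ := ((hS p hp _ hε3).and
    ((tendsto_iff.1 hS' p hp).eventually_lt_const hε3)).exists
  filter_upwards [hk1, (tendsto_iff.1 (hu k) p hp).eventually_lt_const hε3] with i h1 h2
  rw [Real.dist_eq, sub_zero, abs_of_nonneg (apply_nonneg p _)]
  have e : S i x - S' x = (S i (u k) - S' (u k)) + (S' (u k) - S' x) - S i (u k - x) := by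
    rw [map_sub]
    abel
  have h3 := map_sub_le_add p ((S i (u k) - S' (u k)) + (S' (u k) - S' x)) (S i (u k - x))
  have h4 := map_add_le_add p (S i (u k) - S' (u k)) (S' (u k) - S' x)
  rw [e]
  linarith

/-- An ε/4 argument gives the Cauchy property; the norm bound is what allows sequential completeness
to produce a limit. -/
theorem CoarseTopology.exists_tendsto_of_approx {S : ℕ → E →L[ℂ] E} {u : ℕ → E} {x : E} {C : ℝ}
    (hS : ∀ p, τ.IsSeminorm p → ∀ ε > 0, ∀ᶠ k in atTop, ∀ᶠ i in atTop, p (S i (u k - x)) < ε)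
    (hu : ∀ k, ∃ y, Tendsto (fun i => S i (u k)) atTop (τ.nhds y))
    (hC : ∀ᶠ i in atTop, ‖S i x‖ ≤ C) : ∃ y, Tendsto (fun i => S i x) atTop (τ.nhds y) := by
  obtain ⟨N₀, hN₀⟩ := eventually_atTop.1 hC
  obtain ⟨y, hy⟩ := exists_tendsto_of_cauchy (τ := τ) (u := fun n => S (n + N₀) x) (C := C)
    (fun n => hN₀ _ (Nat.le_add_left _ _)) fun p hp ε hε => by
      have hε4 : 0 < ε / 4 := by positivity
      obtain ⟨k, hk⟩ := (hS p hp _ hε4).exists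
      obtain ⟨y, hy⟩ := hu k
      obtain ⟨N, hN⟩ := eventually_atTop.1
        (hk.and ((tendsto_iff.1 hy p hp).eventually_lt_const hε4))
      refine ⟨N, fun m hm n hn => ?_⟩
      obtain ⟨h1, h2⟩ := hN (m + N₀) (hm.trans (Nat.le_add_right _ _))
      obtain ⟨h3, h4⟩ := hN (n + N₀) (hn.trans (Nat.le_add_right _ _))
      have e : S (m + N₀) x - S (n + N₀) x =
          ((S (m + N₀) (u k) - y) - (S (n + N₀) (u k) - y)) -
            (S (m + N₀) (u k - x) - S (n + N₀) (u k - x)) := by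
        simp only [map_sub]
        abel
      have h5 := map_sub_le_add p ((S (m + N₀) (u k) - y) - (S (n + N₀) (u k) - y))
        (S (m + N₀) (u k - x) - S (n + N₀) (u k - x))
      have h6 := map_sub_le_add p (S (m + N₀) (u k) - y) (S (n + N₀) (u k) - y)
      have h7 := map_sub_le_add p (S (m + N₀) (u k - x)) (S (n + N₀) (u k - x))
      rw [e]
      linarith
  refine ⟨y, tendsto_iff.2 fun p hp => ?_⟩
  exact (tendsto_add_atTop_iff_nat (f := fun n => p (S n x - y)) N₀).1 (tendsto_iff.1 hy p hp)

theorem CoarseTopology.seminorm_le_of_tendsto {ι : Type*} {u : ι → E} {l : Filter ι} [NeBot l]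
    {x : E} {p : Seminorm ℂ E} (hp : τ.IsSeminorm p) {c : ℝ} (h : Tendsto u l (τ.nhds x))
    (hc : ∀ᶠ i in l, p (u i) ≤ c) : p x ≤ c := by
  have h1 : Tendsto (fun i => p (u i - x) + c) l (𝓝 (0 + c)) :=
    (tendsto_iff.1 h p hp).add_const c
  rw [zero_add] at h1
  refine ge_of_tendsto h1 ?_
  filter_upwards [hc] with i hi
  calc p x = p (u i - (u i - x)) := by simp
    _ ≤ p (u i) + p (u i - x) := map_sub_le_add p _ _
    _ ≤ _ := by linarith

end Approximation

/-! ### The Euler approximations -/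

section EulerApprox

variable {τ : CoarseTopology E} {A : E →ₗ.[ℂ] E} {M ω α : ℝ}

/-- The Euler approximation `(1 - (t/n)A)⁻ⁿ`. -/
def eulerApprox (A : E →ₗ.[ℂ] E) (t : ℝ) (n : ℕ) : E →L[ℂ] E := eulerStep A (t / n) ^ n

/-- An inequality, so as to include n = 0, where the quotient is 0. -/
theorem nat_mul_div_le {t : ℝ} (ht : 0 ≤ t) (n : ℕ) : n * (t / n) ≤ t := by
  rcases eq_or_ne (n : ℝ) 0 with h | h
  · simpa [h] using ht
  · rw [mul_div_cancel₀ _ h]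

theorem eventually_div_mul_le (t α : ℝ) : ∀ᶠ n : ℕ in atTop, 0 < n ∧ t / n * α ≤ 1 / 2 := by
  have h : Tendsto (fun n : ℕ => t / n * α) atTop (𝓝 (0 * α)) :=
    (tendsto_const_div_atTop_nhds_zero_nat t).mul_const α
  rw [zero_mul] at h
  exact (eventually_gt_atTop 0).and (h.eventually_le_const (by norm_num))

theorem mul_lt_one_of_mul_le (hα : ω < α) {h : ℝ} (h0 : 0 ≤ h) (h1 : h * α ≤ 1 / 2) :
    ω * h < 1 := by nlinarith

/-- With s = 1/h one has s - α = (1 - hα)s, so J_h^k is (1 - hα)^{-k} times a member of the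
bi-equicontinuous family, and that factor is at most e^{2αb}. -/
theorem eventually_seminorm_eulerStep_pow_lt (hα0 : 0 < α)
    (hbe : BiEquicontinuous τ (fun i : ℕ × Set.Ici α =>
      ((((i.2 : ℝ) - α : ℝ) : ℂ) ^ i.1) • resolvent A ((i.2 : ℝ) : ℂ) ^ i.1))
    {u : ℕ → E} (hb : ∃ C : ℝ, ∀ n, ‖u n‖ ≤ C) (hu : Tendsto u atTop (τ.nhds 0))
    {p : Seminorm ℂ E} (hp : τ.IsSeminorm p) (b : ℝ) {ε : ℝ} (hε : 0 < ε) :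
    ∀ᶠ n in atTop, ∀ (h : ℝ) (k : ℕ), 0 ≤ h → h * α ≤ 1 / 2 → k * h ≤ b →
      p ((eulerStep A h ^ k) (u n)) < ε := by
  filter_upwards [biEquicontinuous_iff.1 hbe u hb hu p hp (ε * Real.exp (-(2 * α * b)))
    (by positivity), (CoarseTopology.tendsto_zero_iff.1 hu p hp).eventually_lt_const hε]
    with n hn hn' h k h0 h1 hk
  rcases h0.eq_or_lt with rfl | h0
  · simpa [eulerStep_zero] using hn'
  have h2 : α < h⁻¹ := by
    rw [← one_div, lt_div_iff₀ h0, mul_comm]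
    linarith
  have h3 := hn (k, ⟨h⁻¹, h2.le⟩)
  have h4 := exp_neg_le_one_sub_pow hα0.le h0.le h1 hk
  have h5 : 0 < (1 - h * α) ^ k := pow_pos (by linarith) k
  simp only [smul_apply, map_smul_eq_mul, norm_pow, Complex.norm_real,
    Real.norm_of_nonneg (sub_nonneg.2 h2.le)] at h3
  rw [eulerStep_of_ne h0.ne', smul_pow]
  simp only [smul_apply, map_smul_eq_mul, norm_pow, Complex.norm_real,
    Real.norm_of_nonneg (inv_nonneg.2 h0.le)]
  have h6 : h⁻¹ - α = (1 - h * α) * h⁻¹ := by field_simp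
  rw [h6, mul_pow, mul_assoc] at h3
  have h7 : (1 - h * α) ^ k * (h⁻¹ ^ k * p ((resolvent A ((h⁻¹ : ℝ) : ℂ) ^ k) (u n))) <
      (1 - h * α) ^ k * ε := h3.trans_le (by rw [mul_comm]; gcongr)
  exact lt_of_mul_lt_mul_left h7 h5.le

variable (hA : IsHilleYosida A M ω) (hM : 1 ≤ M) (hα : ω < α) (hα0 : 0 < α)

include hA hM hα hα0

theorem norm_eulerApprox_apply_le {t : ℝ} (ht : 0 ≤ t) {n : ℕ} (hn : t / n * α ≤ 1 / 2) (x : E) :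
    ‖eulerApprox A t n x‖ ≤ M * Real.exp (2 * α * t) * ‖x‖ :=
  hA.norm_eulerStep_pow_apply_le hM hα hα0 (by positivity) hn (nat_mul_div_le ht n) x

/-- One step of length t/n and N steps of length t/(nN) both equal x + (t/n)y up to second order;
telescoping over n blocks gives a bound independent of `N`. -/
theorem norm_eulerApprox_sub_mul_le {t : ℝ} (ht : 0 ≤ t) {n N : ℕ} (hn0 : 0 < n) (hN0 : 0 < N)
    (hn : t / n * α ≤ 1 / 2) {x y z : E} (hxy : (x, y) ∈ A.graph) (hyz : (y, z) ∈ A.graph) :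
    ‖eulerApprox A t n x - eulerApprox A t (n * N) x‖ ≤
      2 * (M * Real.exp (2 * α * t)) ^ 3 * t ^ 2 * ‖z‖ / n := by
  set K := M * Real.exp (2 * α * t) with hK
  have hK0 : 0 ≤ K := by positivity
  have hn' : (0 : ℝ) < n := by exact_mod_cast hn0
  have hN' : (0 : ℝ) < N := by exact_mod_cast hN0
  set δ : ℝ := t / (n * N : ℕ) with hδ
  have hδN : N * δ = t / n := by
    rw [hδ]
    push_cast
    field_simp
  have hδ0 : 0 ≤ δ := by positivity
  have hδ1 : δ * α ≤ 1 / 2 := by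
    refine le_trans ?_ hn
    gcongr
    rw [← hδN]
    exact le_mul_of_one_le_left hδ0 (by exact_mod_cast hN0)
  have hn1 : 0 ≤ t / n := by positivity
  have hb := fun {h : ℝ} {k : ℕ} => hA.norm_eulerStep_pow_apply_le (b := t) (h := h) (k := k)
    hM hα hα0
  have hcomm : Commute (eulerStep A (t / n)) (eulerStep A δ ^ N) :=
    (hA.commute_eulerStep hn1 (mul_lt_one_of_mul_le hα hn1 hn) hδ0
      (mul_lt_one_of_mul_le hα hδ0 hδ1)).pow_right N
  have hmixed := norm_pow_sub_pow_le hcomm (n := n) (K := K * K) (fun i j hi hj w => by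
    refine (hb hn1 hn (le_trans (by gcongr) (nat_mul_div_le ht n)) _).trans ?_
    rw [← hK, mul_assoc K, ← pow_mul]
    refine mul_le_mul_of_nonneg_left ?_ hK0
    refine hb hδ0 hδ1 ?_ w
    push_cast
    rw [mul_comm (N : ℝ), mul_assoc, hδN]
    exact le_trans (by gcongr) (nat_mul_div_le ht n)) x
  have hP := hA.norm_eulerStep_pow_sub_sub_le hn1 (mul_lt_one_of_mul_le hα hn1 hn) hxy hyz
    (N := 1) (K := K * ‖z‖) (fun j hj => hb hn1 hn (le_trans
      (mul_le_mul_of_nonneg_right (by exact_mod_cast hj.trans hn0) hn1) (nat_mul_div_le ht n)) z)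
  have hQ := hA.norm_eulerStep_pow_sub_sub_le hδ0 (mul_lt_one_of_mul_le hα hδ0 hδ1) hxy hyz
    (N := N) (K := K * ‖z‖) (fun j hj => hb hδ0 hδ1 (by
      calc (j : ℝ) * δ ≤ N * δ := by gcongr
        _ = t / n := hδN
        _ ≤ t := div_le_self ht (by exact_mod_cast hn0)) z)
  rw [hδN] at hQ
  simp only [Nat.cast_one, one_mul, pow_one] at hP
  have hPQ : ‖eulerStep A (t / n) x - (eulerStep A δ ^ N) x‖ ≤ 2 * (K * ‖z‖ * (t / n) ^ 2) := by
    have e : eulerStep A (t / n) x - (eulerStep A δ ^ N) x =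
      (eulerStep A (t / n) x - x - ((t / n : ℝ) : ℂ) • y) -
        ((eulerStep A δ ^ N) x - x - ((t / n : ℝ) : ℂ) • y) := by abel
    rw [e, two_mul]
    exact norm_sub_le_of_le hP hQ
  rw [← pow_mul, mul_comm N n] at hmixed
  calc ‖eulerApprox A t n x - eulerApprox A t (n * N) x‖
      ≤ n * (K * K * (2 * (K * ‖z‖ * (t / n) ^ 2))) := hmixed.trans (by gcongr)
    _ = _ := by field_simp

theorem exists_tendsto_eulerApprox_of_mem [CompleteSpace E] {t : ℝ} (ht : 0 ≤ t) {x y z : E}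
    (hxy : (x, y) ∈ A.graph) (hyz : (y, z) ∈ A.graph) :
    ∃ w, Tendsto (fun n => eulerApprox A t n x) atTop (𝓝 w) := by
  refine cauchySeq_tendsto_of_complete (Metric.cauchySeq_iff.2 fun ε hε => ?_)
  have h1 := (tendsto_const_div_atTop_nhds_zero_nat
    (2 * (M * Real.exp (2 * α * t)) ^ 3 * t ^ 2 * ‖z‖)).eventually_lt_const (half_pos hε)
  obtain ⟨N, hN⟩ := eventually_atTop.1 (h1.and (eventually_div_mul_le t α))
  refine ⟨N, fun m hm n hn => ?_⟩
  obtain ⟨hm1, hm0, hm2⟩ := hN m hm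
  obtain ⟨hn1, hn0, hn2⟩ := hN n hn
  -- Both approximations are compared with their common refinement of m n steps.
  have h2 := norm_eulerApprox_sub_mul_le hA hM hα hα0 ht hm0 hn0 hm2 hxy hyz
  have h3 := norm_eulerApprox_sub_mul_le hA hM hα hα0 ht hn0 hm0 hn2 hxy hyz
  rw [mul_comm n m] at h3
  rw [← dist_eq_norm] at h2 h3
  calc dist (eulerApprox A t m x) (eulerApprox A t n x) ≤ _ := dist_triangle_right _ _ _
    _ < ε := by linarith

/-- Approximation by elements of `D(A²)`. -/
theorem exists_seq_mem_sq (hd : IsBiDenselyDefined τ A) (x : E) :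
    ∃ u v w : ℕ → E, (∀ n, (u n, v n) ∈ A.graph) ∧ (∀ n, (v n, w n) ∈ A.graph) ∧
      (∃ C : ℝ, ∀ n, ‖u n‖ ≤ C) ∧ Tendsto u atTop (τ.nhds x) := by
  obtain ⟨u, hu, ⟨C, hC⟩, hux⟩ := hd x
  set y : ℕ → E := fun n => A ⟨u n, hu n⟩ with hy
  have hxy (n : ℕ) : (u n, y n) ∈ A.graph := A.mem_graph ⟨u n, hu n⟩
  -- One Euler step carries D(A) into D(A²). Its length depends on n because ‖A u_n‖ may be
  -- unbounded.
  have hstep (n : ℕ) : ∃ h : ℝ, 0 < h ∧ ω * h < 1 ∧ ‖eulerStep A h (u n) - u n‖ ≤ 1 / ((n : ℝ) + 1) := by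
    have h1 : Tendsto (fun h : ℝ => M * Real.exp (2 * α * h) * ‖y n‖ * h) (𝓝[>] 0) (𝓝 0) := by
      refine Tendsto.mono_left ?_ nhdsWithin_le_nhds
      exact Continuous.tendsto' (by fun_prop) _ _ (by simp)
    have h2 : Tendsto (fun h : ℝ => h * α) (𝓝[>] 0) (𝓝 0) := by
      refine Tendsto.mono_left ?_ nhdsWithin_le_nhds
      exact Continuous.tendsto' (by fun_prop) _ _ (by simp)
    obtain ⟨h, hh1, hh2, hh0⟩ := ((h1.eventually_le_const (Nat.one_div_pos_of_nat (n := n))).and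
      ((h2.eventually_le_const (show (0 : ℝ) < 1 / 2 by norm_num)).and self_mem_nhdsWithin)).exists
    have hh0' : 0 < h := hh0
    have hh3 := mul_lt_one_of_mul_le hα hh0'.le hh2
    refine ⟨h, hh0', hh3, le_trans ?_ hh1⟩
    rw [hA.eulerStep_apply hh0'.le hh3 (hxy n), add_sub_cancel_left, norm_smul, Complex.norm_real,
      Real.norm_of_nonneg hh0'.le, mul_comm]
    gcongr
    simpa using hA.norm_eulerStep_pow_apply_le hM hα hα0 hh0'.le hh2 (k := 1) (b := h) (by simp) (y n)
  choose h hh0 hh1 hh2 using hstep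
  have hdom (n : ℕ) : (eulerStep A (h n) (y n), ((h n : ℂ)⁻¹ • (eulerStep A (h n) (y n) - y n)))
      ∈ A.graph := by
    have h3 := A.graph.smul_mem ((h n : ℂ)⁻¹)
      ((hA.isResolventAt (hh0 n) (hh1 n)).mem_graph (y n))
    rw [eulerStep_of_ne (hh0 n).ne']
    convert! h3 using 1
    refine Prod.ext ?_ ?_ <;> simp
  refine ⟨fun n => eulerStep A (h n) (u n), _, _,
    fun n => hA.eulerStep_mem_graph (hh0 n).le (hh1 n) (hxy n), hdom, ⟨C + 1, fun n => ?_⟩, ?_⟩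
  · calc ‖eulerStep A (h n) (u n)‖ = ‖u n + (eulerStep A (h n) (u n) - u n)‖ := by simp
      _ ≤ C + 1 := norm_add_le_of_le (hC n) ((hh2 n).trans
        ((div_le_one (by positivity)).2 (by linarith [n.cast_nonneg (α := ℝ)])))
  · have h3 : Tendsto (fun n => eulerStep A (h n) (u n) - u n) atTop (𝓝 0) :=
      squeeze_zero_norm hh2 tendsto_one_div_add_atTop_nhds_zero_nat
    simpa using CoarseTopology.tendsto_add (CoarseTopology.tendsto_of_tendsto_norm (τ := τ) h3) hux

variable (hbe : BiEquicontinuous τ (fun i : ℕ × Set.Ici α =>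
      ((((i.2 : ℝ) - α : ℝ) : ℂ) ^ i.1) • resolvent A ((i.2 : ℝ) : ℂ) ^ i.1))

include hbe
omit hM hA hα

theorem eventually_eventually_seminorm_eulerApprox_lt {t : ℝ} (ht : 0 ≤ t) {u : ℕ → E}
    (hb : ∃ C : ℝ, ∀ n, ‖u n‖ ≤ C) (hu : Tendsto u atTop (τ.nhds 0)) {p : Seminorm ℂ E}
    (hp : τ.IsSeminorm p) {ε : ℝ} (hε : 0 < ε) :
    ∀ᶠ k in atTop, ∀ᶠ n in atTop, p (eulerApprox A t n (u k)) < ε := by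
  filter_upwards [eventually_seminorm_eulerStep_pow_lt hα0 hbe hb hu hp t hε] with k hk
  filter_upwards [eventually_div_mul_le t α] with n hn
  exact hk _ _ (by positivity) hn.2 (nat_mul_div_le ht n)

include hM hA hα

theorem exists_tendsto_eulerApprox [CompleteSpace E] (hd : IsBiDenselyDefined τ A) {t : ℝ}
    (ht : 0 ≤ t) : ∃ S : E →L[ℂ] E, ∀ x, Tendsto (fun n => eulerApprox A t n x) atTop
      (τ.nhds (S x)) := by
  have hex (x : E) : ∃ y, Tendsto (fun n => eulerApprox A t n x) atTop (τ.nhds y) := by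
    obtain ⟨u, v, w, huv, hvw, ⟨C, hC⟩, hu⟩ := exists_seq_mem_sq hA hM hα hα0 hd x
    refine CoarseTopology.exists_tendsto_of_approx (u := u)
      (C := M * Real.exp (2 * α * t) * ‖x‖) (fun p hp ε hε => ?_) (fun k => ?_) ?_
    · refine eventually_eventually_seminorm_eulerApprox_lt hα0 hbe ht ⟨C + ‖x‖, fun n => ?_⟩
        (CoarseTopology.tendsto_sub_iff.2 hu) hp hε
      exact norm_sub_le_of_le (hC n) le_rfl
    · obtain ⟨y, hy⟩ := exists_tendsto_eulerApprox_of_mem hA hM hα hα0 ht (huv k) (hvw k)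
      exact ⟨y, CoarseTopology.tendsto_of_tendsto_norm hy⟩
    · filter_upwards [eventually_div_mul_le t α] with n hn
      exact norm_eulerApprox_apply_le hA hM hα hα0 ht hn.2 x
  choose S hS using hex
  let L : E →ₗ[ℂ] E :=
    { toFun := S
      map_add' := fun x y => CoarseTopology.tendsto_nhds_unique (hS (x + y)) (by
        simpa only [map_add] using CoarseTopology.tendsto_add (hS x) (hS y))
      map_smul' := fun c x => CoarseTopology.tendsto_nhds_unique (hS (c • x)) (by
        simpa only [map_smul, RingHom.id_apply] using CoarseTopology.tendsto_const_smul c (hS x)) }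
  refine ⟨L.mkContinuous (M * Real.exp (2 * α * t)) fun x => ?_, hS⟩
  refine CoarseTopology.norm_le_of_tendsto (hS x) ?_ tendsto_const_nhds
  filter_upwards [eventually_div_mul_le t α] with n hn
  exact norm_eulerApprox_apply_le hA hM hα hα0 ht hn.2 x

end EulerApprox

/-! ### The semigroup generated by a Hille–Yosida operator -/

section Generation

variable {τ : CoarseTopology E} {A : E →ₗ.[ℂ] E} {M ω α : ℝ} {T : ℝ≥0 → E →L[ℂ] E}

theorem CoarseTopology.tendsto_const (x : E) {ι : Type*} {l : Filter ι} :
    Tendsto (fun _ : ι => x) l (τ.nhds x) :=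
  tendsto_of_tendsto_norm tendsto_const_nhds

theorem SeqContinuous.const_smul {S : E →L[ℂ] E} (hS : SeqContinuous τ S) (c : ℂ) :
    SeqContinuous τ (c • S) := fun u hb hu => by
  simpa using CoarseTopology.tendsto_const_smul c (hS u hb hu)

/-- The limit (1 - ωt/n)^{-n} → e^{ωt} recovers the sharp type, which the stability constant e^{2αt}
would lose. -/
theorem hasType_of_tendsto_eulerApprox (hA : IsHilleYosida A M ω) (hM : 1 ≤ M)
    (hlim : ∀ (t : ℝ≥0) x, Tendsto (fun n => eulerApprox A t n x) atTop (τ.nhds (T t x))) :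
    HasType T M ω := by
  intro t
  refine ContinuousLinearMap.opNorm_le_bound _ (by positivity) fun x => ?_
  have h1 : Tendsto (fun n : ℕ => ω * (t / n : ℝ)) atTop (𝓝 (ω * 0)) :=
    (tendsto_const_div_atTop_nhds_zero_nat (t : ℝ)).const_mul ω
  rw [mul_zero] at h1
  refine CoarseTopology.norm_le_of_tendsto (hlim t x)
    (b := fun n : ℕ => M / (1 + (-(ω * t)) / n) ^ n * ‖x‖) ?_ ?_
  · filter_upwards [h1.eventually_lt_const one_pos] with n hn
    have h2 := hA.norm_eulerStep_pow_le hM (by positivity) hn n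
    convert (eulerApprox A t n).le_of_opNorm_le h2 x using 4
    ring
  · have h2 := Real.tendsto_one_add_div_pow_exp (-(ω * t))
    have h3 := ((tendsto_const_nhds (x := M)).div h2 (Real.exp_ne_zero _)).mul_const ‖x‖
    rw [Real.exp_neg, div_inv_eq_mul] at h3
    exact h3

/-- Continuity at 0 propagates in both directions: the later of two times is written as the earlier
plus d, and T(a)(T(d)x - x) is estimated. -/
theorem continuous_orbit (hadd : ∀ s t : ℝ≥0, T (t + s) = (T t).comp (T s)) (h : HasType T M ω)
    {x : E} (hx : Tendsto (fun d => T d x) (𝓝 0) (𝓝 x)) : Continuous fun t => T t x := by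
  refine continuous_iff_continuousAt.2 fun t => tendsto_iff_norm_sub_tendsto_zero.2 ?_
  have hM := h.nonneg
  have hd : Tendsto (fun s => nndist s t) (𝓝 t) (𝓝 0) :=
    Continuous.tendsto' (by fun_prop) _ _ (nndist_self t)
  have h0 : Tendsto (fun s => M * Real.exp (|ω| * t) * ‖T (nndist s t) x - x‖) (𝓝 t) (𝓝 0) := by
    simpa using ((tendsto_iff_norm_sub_tendsto_zero.1 hx).comp hd).const_mul
      (M * Real.exp (|ω| * t))
  have hle (a d : ℝ≥0) (ha : a ≤ t) :
      ‖T (a + d) x - T a x‖ ≤ M * Real.exp (|ω| * t) * ‖T d x - x‖ := by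
    rw [hadd, ContinuousLinearMap.comp_apply, ← map_sub, ← onReal_coe (T := T) a]
    exact h.norm_onReal_le_of_le a.2 (b := t) ha _
  refine squeeze_zero (fun _ => norm_nonneg _) (fun s => ?_) h0
  rcases le_total s t with hst | hst
  · obtain ⟨d, rfl⟩ := exists_add_of_le hst
    rw [norm_sub_rev, show nndist s (s + d) = d by ext; simp [NNReal.dist_eq]]
    exact hle s d le_self_add
  · obtain ⟨d, rfl⟩ := exists_add_of_le hst
    rw [show nndist (t + d) t = d by ext; simp [NNReal.dist_eq]]
    exact hle t d le_rfl

theorem biEquicontinuous_of_tendsto_eulerApprox (hα0 : 0 < α)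
    (hbe : BiEquicontinuous τ (fun i : ℕ × Set.Ici α =>
      ((((i.2 : ℝ) - α : ℝ) : ℂ) ^ i.1) • resolvent A ((i.2 : ℝ) : ℂ) ^ i.1))
    (hlim : ∀ (t : ℝ≥0) x, Tendsto (fun n => eulerApprox A t n x) atTop (τ.nhds (T t x)))
    (b : ℝ≥0) : BiEquicontinuous τ (fun s : Set.Iic b => T s) := by
  rw [biEquicontinuous_iff]
  intro u hb hu p hp ε hε
  filter_upwards [eventually_seminorm_eulerStep_pow_lt hα0 hbe hb hu hp b (half_pos hε)] with n hn
  rintro ⟨s, hs⟩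
  have hs' : (s : ℝ) ≤ b := hs
  refine (CoarseTopology.seminorm_le_of_tendsto hp (hlim s (u n)) (c := ε / 2) ?_).trans_lt
    (half_lt_self hε)
  filter_upwards [eventually_div_mul_le s α] with k hk
  exact (hn _ _ (by positivity) hk.2 ((nat_mul_div_le s.2 k).trans hs')).le

/-! ### The limit of the Euler approximations is a semigroup generated by A. -/

section

variable (hA : IsHilleYosida A M ω) (hM : 1 ≤ M) (hα : ω < α) (hα0 : 0 < α)

include hA hM hα hα0

/-- Telescoping for J_a J_b against J_{a+b}, which agree to first order on D(A²). The constant is K³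
for the mixed powers times 4K² for the four remainders in `e`. -/
theorem norm_eulerApprox_comp_sub_le {t s : ℝ} (ht : 0 ≤ t) (hs : 0 ≤ s) {n : ℕ} (hn0 : 0 < n)
    (hn : (t + s) / n * α ≤ 1 / 2) {x y z : E} (hxy : (x, y) ∈ A.graph)
    (hyz : (y, z) ∈ A.graph) :
    ‖eulerApprox A t n (eulerApprox A s n x) - eulerApprox A (t + s) n x‖ ≤
      4 * (M * Real.exp (2 * α * (t + s))) ^ 5 * (t + s) ^ 2 * ‖z‖ / n := by
  set K := M * Real.exp (2 * α * (t + s)) with hK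
  have hK1 : 1 ≤ K := one_le_mul_of_one_le_of_one_le hM (Real.one_le_exp (by positivity))
  have hK0 : 0 ≤ K := zero_le_one.trans hK1
  have hn' : (0 : ℝ) < n := by exact_mod_cast hn0
  set a := t / n with ha
  set b := s / n with hb
  have hab : (t + s) / n = a + b := add_div _ _ _
  rw [hab] at hn
  have ha0 : 0 ≤ a := by positivity
  have hb0 : 0 ≤ b := by positivity
  have ha1 : a * α ≤ 1 / 2 := le_trans (by gcongr; linarith) hn
  have hb1 : b * α ≤ 1 / 2 := le_trans (by gcongr; linarith) hn
  have hab0 : 0 ≤ a + b := by positivity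
  have hwa := mul_lt_one_of_mul_le hα ha0 ha1
  have hwb := mul_lt_one_of_mul_le hα hb0 hb1
  have hwab := mul_lt_one_of_mul_le hα hab0 hn
  have hle (i : ℕ) (hi : i ≤ n) : i * (a + b) ≤ t + s := by
    rw [← hab]
    exact le_trans (by gcongr) (nat_mul_div_le (by positivity) n)
  have hba (i : ℕ) (hi : i ≤ n) (w : E) : ‖(eulerStep A a ^ i) w‖ ≤ K * ‖w‖ :=
    hA.norm_eulerStep_pow_apply_le hM hα hα0 ha0 ha1
      (le_trans (by gcongr; linarith) (hle i hi)) w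
  have hbb (i : ℕ) (hi : i ≤ n) (w : E) : ‖(eulerStep A b ^ i) w‖ ≤ K * ‖w‖ :=
    hA.norm_eulerStep_pow_apply_le hM hα hα0 hb0 hb1
      (le_trans (by gcongr; linarith) (hle i hi)) w
  have hbab (i : ℕ) (hi : i ≤ n) (w : E) : ‖(eulerStep A (a + b) ^ i) w‖ ≤ K * ‖w‖ :=
    hA.norm_eulerStep_pow_apply_le hM hα hα0 hab0 hn (hle i hi) w
  have hc1 := hA.commute_eulerStep ha0 hwa hb0 hwb
  have hc2 := (hA.commute_eulerStep ha0 hwa hab0 hwab).mul_left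
    (hA.commute_eulerStep hb0 hwb hab0 hwab)
  have hmixed := norm_pow_sub_pow_le hc2 (n := n) (K := K * (K * K)) (fun i j hi hj w => by
    rw [hc1.mul_pow, mul_apply_eq_comp]
    calc _ ≤ K * (K * (K * ‖w‖)) := (hba i hi _).trans (by
            gcongr
            exact (hbb i hi _).trans (by gcongr; exact hbab j hj _))
      _ = _ := by ring) x
  have key (c : ℝ) (hc0 : 0 ≤ c) (hc1 : ω * c < 1) (hcb : ∀ i ≤ n, ∀ w,
      ‖(eulerStep A c ^ i) w‖ ≤ K * ‖w‖) : ‖eulerStep A c x - x - (c : ℂ) • y‖ ≤ K * ‖z‖ * c ^ 2 := by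
    have := hA.norm_eulerStep_pow_sub_sub_le hc0 hc1 hxy hyz (N := 1) (K := K * ‖z‖)
      fun j hj => hcb j (hj.trans hn0) z
    simpa using this
  have h1 := key a ha0 hwa hba
  have h2 := key b hb0 hwb hbb
  have h3 := key (a + b) hab0 hwab hbab
  have h4 : ‖eulerStep A a y - y‖ ≤ K * ‖z‖ * a := by
    have := hA.norm_eulerStep_pow_sub_le ha0 hwa hyz (N := 1) (K := K * ‖z‖)
      fun j hj => hba j (hj.trans hn0) z
    simpa using this
  have h5 : ‖(b : ℂ) • (eulerStep A a y - y)‖ ≤ b * (K * ‖z‖ * a) := by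
    rw [norm_smul, Complex.norm_real, Real.norm_of_nonneg hb0]
    gcongr
  have h6 : ‖eulerStep A a (eulerStep A b x - x - (b : ℂ) • y)‖ ≤ K * (K * ‖z‖ * b ^ 2) := by
    have := hba 1 hn0 (eulerStep A b x - x - (b : ℂ) • y)
    rw [pow_one] at this
    exact this.trans (by gcongr)
  have e : (eulerStep A a * eulerStep A b) x - eulerStep A (a + b) x =
      (eulerStep A a x - x - (a : ℂ) • y) + (b : ℂ) • (eulerStep A a y - y) +
        eulerStep A a (eulerStep A b x - x - (b : ℂ) • y) -
        (eulerStep A (a + b) x - x - ((a + b : ℝ) : ℂ) • y) := by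
    rw [mul_apply_eq_comp]
    simp only [map_sub, map_smul]
    push_cast
    module
  have h7 : ‖(eulerStep A a * eulerStep A b) x - eulerStep A (a + b) x‖ ≤
      4 * (K ^ 2 * ‖z‖ * (a + b) ^ 2) := by
    rw [e]
    refine (norm_sub_le_of_le (norm_add_le_of_le (norm_add_le_of_le h1 h5) h6) h3).trans ?_
    have hKK : K * ‖z‖ ≤ K ^ 2 * ‖z‖ := by
      gcongr
      exact le_self_pow₀ hK1 two_ne_zero
    have i1 : K * ‖z‖ * a ^ 2 ≤ K ^ 2 * ‖z‖ * (a + b) ^ 2 := by gcongr; linarith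
    have i2 : b * (K * ‖z‖ * a) ≤ K ^ 2 * ‖z‖ * (a + b) ^ 2 := by
      calc b * (K * ‖z‖ * a) = K * ‖z‖ * (b * a) := by ring
        _ ≤ _ := by gcongr; nlinarith
    have i3 : K * (K * ‖z‖ * b ^ 2) ≤ K ^ 2 * ‖z‖ * (a + b) ^ 2 := by
      calc K * (K * ‖z‖ * b ^ 2) = K ^ 2 * ‖z‖ * b ^ 2 := by ring
        _ ≤ _ := by gcongr; linarith
    have i4 : K * ‖z‖ * (a + b) ^ 2 ≤ K ^ 2 * ‖z‖ * (a + b) ^ 2 := by gcongr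
    linarith
  rw [hc1.mul_pow, mul_apply_eq_comp] at hmixed
  calc ‖eulerApprox A t n (eulerApprox A s n x) - eulerApprox A (t + s) n x‖
      ≤ n * (K * (K * K) * (4 * (K ^ 2 * ‖z‖ * (a + b) ^ 2))) := by
        rw [eulerApprox, eulerApprox, eulerApprox, hab]
        exact hmixed.trans (by gcongr)
    _ = _ := by
        rw [← hab]
        field_simp

variable (hlim : ∀ (t : ℝ≥0) x, Tendsto (fun n => eulerApprox A t n x) atTop (τ.nhds (T t x)))

include hlim

theorem norm_sub_sub_le_of_tendsto_eulerApprox {x y z : E} (hxy : (x, y) ∈ A.graph)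
    (hyz : (y, z) ∈ A.graph) (t : ℝ≥0) :
    ‖T t x - x - ((t : ℝ) : ℂ) • y‖ ≤ M * Real.exp (2 * α * t) * ‖z‖ * t ^ 2 := by
  refine CoarseTopology.norm_le_of_tendsto (CoarseTopology.tendsto_sub
    (CoarseTopology.tendsto_sub (hlim t x) (CoarseTopology.tendsto_const x))
      (CoarseTopology.tendsto_const _)) ?_ tendsto_const_nhds
  filter_upwards [eventually_div_mul_le t α] with n hn
  have hn0 : 0 ≤ (t / n : ℝ) := by positivity
  have h1 := hA.norm_eulerStep_pow_sub_sub_le hn0 (mul_lt_one_of_mul_le hα hn0 hn.2) hxy hyz (N := n)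
    (K := M * Real.exp (2 * α * t) * ‖z‖) fun j hj => hA.norm_eulerStep_pow_apply_le hM hα hα0 hn0
      hn.2 (le_trans (mul_le_mul_of_nonneg_right (by exact_mod_cast hj) hn0) (nat_mul_div_le t.2 n)) z
  rwa [mul_div_cancel₀ _ (by exact_mod_cast hn.1.ne')] at h1

/-- On D(A²) the inner approximation converges in norm, so the uniformly bounded outer ones may be
applied to its error. Bi-density and sequential continuity extend the law to all x. -/
theorem map_add_of_tendsto_eulerApprox [CompleteSpace E] (hd : IsBiDenselyDefined τ A)
    (hbe : BiEquicontinuous τ (fun i : ℕ × Set.Ici α =>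
      ((((i.2 : ℝ) - α : ℝ) : ℂ) ^ i.1) • resolvent A ((i.2 : ℝ) : ℂ) ^ i.1)) (s t : ℝ≥0) :
    T (t + s) = (T t).comp (T s) := by
  have hsc (t : ℝ≥0) : SeqContinuous τ (T t) :=
    (biEquicontinuous_of_tendsto_eulerApprox hα0 hbe hlim t).seqContinuous ⟨t, le_refl t⟩
  have h2 {x y z : E} (hxy : (x, y) ∈ A.graph) (hyz : (y, z) ∈ A.graph) :
      T (t + s) x = T t (T s x) := by
    have hs : Tendsto (fun n => eulerApprox A s n x) atTop (𝓝 (T s x)) := by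
      obtain ⟨w, hw⟩ := exists_tendsto_eulerApprox_of_mem hA hM hα hα0 s.2 hxy hyz
      rwa [CoarseTopology.tendsto_nhds_unique (hlim s x) (CoarseTopology.tendsto_of_tendsto_norm hw)]
    have h3 : Tendsto (fun n => eulerApprox A t n (eulerApprox A s n x - T s x)) atTop (𝓝 0) := by
      have h0 : Tendsto (fun n => M * Real.exp (2 * α * t) * ‖eulerApprox A s n x - T s x‖) atTop
          (𝓝 0) := by
        simpa using (tendsto_iff_norm_sub_tendsto_zero.1 hs).const_mul (M * Real.exp (2 * α * t))
      refine squeeze_zero_norm' ?_ h0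
      filter_upwards [eventually_div_mul_le t α] with n hn
      exact norm_eulerApprox_apply_le hA hM hα hα0 t.2 hn.2 _
    have h4 : Tendsto (fun n => eulerApprox A t n (eulerApprox A s n x) -
        eulerApprox A (t + s) n x) atTop (𝓝 0) := by
      refine squeeze_zero_norm' ?_ (tendsto_const_div_atTop_nhds_zero_nat
        (4 * (M * Real.exp (2 * α * (t + s))) ^ 5 * (t + s) ^ 2 * ‖z‖))
      filter_upwards [eventually_div_mul_le (t + s) α] with n hn
      exact norm_eulerApprox_comp_sub_le hA hM hα hα0 t.2 s.2 hn.1 hn.2 hxy hyz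
    have h5 := CoarseTopology.tendsto_sub (CoarseTopology.tendsto_add
      (CoarseTopology.tendsto_of_tendsto_norm (τ := τ) h3) (hlim t (T s x)))
      (CoarseTopology.tendsto_of_tendsto_norm h4)
    simp only [map_sub, sub_add_cancel, sub_sub_cancel, zero_add, sub_zero] at h5
    exact CoarseTopology.tendsto_nhds_unique (hlim (t + s) x) h5
  ext x
  obtain ⟨u, v, w, huv, hvw, ⟨C, hC⟩, hu⟩ := exists_seq_mem_sq hA hM hα hα0 hd x
  have h3 := (hsc (t + s)).tendsto (.of_forall hC) hu
  simp only [h2 (huv _) (hvw _)] at h3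
  refine CoarseTopology.tendsto_nhds_unique h3 ?_
  exact (hsc t).tendsto (.of_forall fun n => (T s).le_opNorm_of_le (hC n))
    ((hsc s).tendsto (.of_forall hC) hu)

theorem isBiContinuousSemigroup_of_tendsto_eulerApprox [CompleteSpace E]
    (hd : IsBiDenselyDefined τ A)
    (hbe : BiEquicontinuous τ (fun i : ℕ × Set.Ici α =>
      ((((i.2 : ℝ) - α : ℝ) : ℂ) ^ i.1) • resolvent A ((i.2 : ℝ) : ℂ) ^ i.1)) :
    IsBiContinuousSemigroup τ T := by
  have htype := hasType_of_tendsto_eulerApprox hA hM hlim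
  have hadd := map_add_of_tendsto_eulerApprox hA hM hα hα0 hlim hd hbe
  have hbeT := biEquicontinuous_of_tendsto_eulerApprox hα0 hbe hlim
  refine ⟨?_, hadd, fun x => ?_, ⟨M, ω, hM, htype⟩, hbeT⟩
  · ext x
    refine CoarseTopology.tendsto_nhds_unique (hlim 0 x) ?_
    simpa [eulerApprox, eulerStep_zero] using CoarseTopology.tendsto_const x
  · refine (@continuous_iff_continuousAt ℝ≥0 E _ τ.top _).2 fun t => ?_
    change Tendsto (fun s => T s x) (𝓝 t) (τ.nhds (T t x))
    obtain ⟨u, v, w, huv, hvw, ⟨C, hC⟩, hu⟩ := exists_seq_mem_sq hA hM hα hα0 hd x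
    refine CoarseTopology.tendsto_of_approx (u := u)
      (((hbeT t).seqContinuous ⟨t, le_refl t⟩).tendsto (.of_forall hC) hu) (fun p hp ε hε => ?_)
      fun k => ?_
    · filter_upwards [biEquicontinuous_iff.1 (hbeT (t + 1)) (fun n => u n - x)
        ⟨C + ‖x‖, fun n => norm_sub_le_of_le (hC n) le_rfl⟩ (CoarseTopology.tendsto_sub_iff.2 hu)
        p hp ε hε] with k hk
      filter_upwards [eventually_le_nhds (show t < t + 1 from lt_add_of_pos_right _ one_pos)]
        with s hs
      exact hk ⟨s, hs⟩
    · refine CoarseTopology.tendsto_of_tendsto_norm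
        ((continuous_orbit hadd htype (tendsto_iff_norm_sub_tendsto_zero.2 ?_)).tendsto t)
      have h0 : Tendsto (fun d : ℝ≥0 => M * Real.exp (2 * α * d) * ‖w k‖ * d ^ 2 + d * ‖v k‖)
          (𝓝 0) (𝓝 0) := Continuous.tendsto' (by fun_prop) _ _ (by simp)
      refine squeeze_zero (fun _ => norm_nonneg _) (fun d => ?_) h0
      have h1 := norm_sub_sub_le_of_tendsto_eulerApprox hA hM hα hα0 hlim (huv k) (hvw k) d
      calc ‖T d (u k) - u k‖
          = ‖(T d (u k) - u k - ((d : ℝ) : ℂ) • v k) + ((d : ℝ) : ℂ) • v k‖ := by simp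
        _ ≤ _ := norm_add_le_of_le h1 (by rw [norm_smul]; simp)

theorem intRel_of_mem_graph_sq (hT : IsBiContinuousSemigroup τ T) {x y z : E}
    (hxy : (x, y) ∈ A.graph) (hyz : (y, z) ∈ A.graph) : IntRel τ T x y := by
  have hsm (t : ℝ≥0) (z : E) : (t : ℝ)⁻¹ • z = ((t : ℝ) : ℂ)⁻¹ • z := by
    rw [← Complex.ofReal_inv, Complex.coe_smul]
  have hbd (t : ℝ≥0) (ht : 0 < t) : ‖(t : ℝ)⁻¹ • (T t x - x) - y‖ ≤
      M * Real.exp (2 * α * t) * ‖z‖ * t := by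
    have ht' : (0 : ℝ) < t := ht
    have hne : ((t : ℝ) : ℂ) ≠ 0 := by exact_mod_cast ht'.ne'
    have h1 := norm_sub_sub_le_of_tendsto_eulerApprox hA hM hα hα0 hlim hxy hyz t
    have e : (t : ℝ)⁻¹ • (T t x - x) - y =
        ((t : ℝ) : ℂ)⁻¹ • (T t x - x - ((t : ℝ) : ℂ) • y) := by
      rw [hsm, smul_sub _ _ (((t : ℝ) : ℂ) • y), smul_smul, inv_mul_cancel₀ hne, one_smul]
    rw [e, norm_smul, norm_inv, Complex.norm_real, Real.norm_of_nonneg ht'.le,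
      inv_mul_le_iff₀ ht']
    exact h1.trans (le_of_eq (by ring))
  refine GenRel.intRel hT ⟨CoarseTopology.tendsto_of_tendsto_norm ?_,
    M * Real.exp (2 * α * 1) * ‖z‖ * 1 + ‖y‖, fun t ht ht1 => ?_⟩
  · refine tendsto_iff_norm_sub_tendsto_zero.2 ?_
    have h0 : Tendsto (fun t : ℝ≥0 => M * Real.exp (2 * α * t) * ‖z‖ * t) (𝓝[>] 0) (𝓝 0) := by
      refine Tendsto.mono_left ?_ nhdsWithin_le_nhds
      exact Continuous.tendsto' (by fun_prop) _ _ (by simp)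
    refine squeeze_zero' (.of_forall fun _ => norm_nonneg _) ?_ h0
    filter_upwards [self_mem_nhdsWithin] with t ht
    exact hbd t ht
  · have ht1' : (t : ℝ) ≤ 1 := ht1
    calc ‖(t : ℝ)⁻¹ • (T t x - x)‖ = ‖((t : ℝ)⁻¹ • (T t x - x) - y) + y‖ := by simp
      _ ≤ _ := norm_add_le_of_le ((hbd t ht).trans (by gcongr)) le_rfl

theorem isBiGenerator_of_tendsto_eulerApprox [CompleteSpace E]
    (hT : IsBiContinuousSemigroup τ T) (hd : IsBiDenselyDefined τ A)
    (hbe : BiEquicontinuous τ (fun i : ℕ × Set.Ici α =>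
      ((((i.2 : ℝ) - α : ℝ) : ℂ) ^ i.1) • resolvent A ((i.2 : ℝ) : ℂ) ^ i.1)) :
    IsBiGenerator τ T A := by
  -- With s - α = 1 the resolvent itself belongs to the bi-equicontinuous family.
  set s : ℝ := α + 1 with hs
  have hωs : ω < s := by linarith
  set R := resolvent A (s : ℂ) with hR
  have hRes : IsResolventAt A s R := isResolventAt_resolvent (hA s hωs).1
  have hRc : SeqContinuous τ R := by
    have h1 : SeqContinuous τ ((((s - α : ℝ) : ℂ) ^ 1) • resolvent A (s : ℂ) ^ 1) :=
      hbe.seqContinuous (1, ⟨s, (le_add_of_nonneg_right zero_le_one : α ≤ α + 1)⟩)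
    rwa [pow_one, pow_one, hs, add_sub_cancel_left, Complex.ofReal_one, one_smul] at h1
  -- Approximating sx - y by u_n in D(A) places R u_n in D(A²), where the relation is known;
  -- bi-closedness carries it to x = R(sx - y).
  have hsub {x y : E} (hxy : (x, y) ∈ A.graph) : IntRel τ T x y := by
    obtain ⟨u, hu, ⟨C, hC⟩, hlimu⟩ := hd ((s : ℂ) • x - y)
    have h1 (n : ℕ) : (R (u n), (s : ℂ) • R (u n) - u n) ∈ A.graph := hRes.mem_graph (u n)
    have h2 (n : ℕ) : (s : ℂ) • R (u n) - u n ∈ A.domain :=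
      A.domain.sub_mem (A.domain.smul_mem _ (LinearPMap.mem_domain_of_mem_graph (h1 n))) (hu n)
    have h3 (n : ℕ) := intRel_of_mem_graph_sq hA hM hα hα0 hlim hT (h1 n) (A.mem_graph ⟨_, h2 n⟩)
    have h4 := hRc.tendsto (.of_forall hC) hlimu
    have hb (n : ℕ) : ‖R (u n)‖ ≤ ‖R‖ * C := R.le_opNorm_of_le (hC n)
    have h5 := CoarseTopology.tendsto_sub (CoarseTopology.tendsto_const_smul (s : ℂ) h4) hlimu
    rw [hRes.apply_of_mem_graph hxy, sub_sub_cancel] at h5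
    rw [hRes.apply_of_mem_graph hxy] at h4
    refine intRel_of_tendsto hT h3 hb (D := ‖(s : ℂ)‖ * (‖R‖ * C) + C) (fun n => ?_) h4 h5
    refine norm_sub_le_of_le ?_ (hC n)
    rw [norm_smul]
    gcongr
    exact hb n
  have htype := hasType_of_tendsto_eulerApprox hA hM hlim
  obtain ⟨Q, hQ⟩ := hT.exists_laplace htype hωs
  refine fun x y => ⟨fun h => (hsub h).genRel hT, fun h => ?_⟩
  -- The Laplace transform Q inverts s minus the generator of T. As A is contained in that
  -- generator, Q and R agree at sx - y, so x = R(sx - y) lies in D(A).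
  have h1 := hQ.apply_of_intRel hT htype hωs (GenRel.intRel hT h)
  have h2 := hRes.mem_graph ((s : ℂ) • x - y)
  have h3 := hQ.apply_of_intRel hT htype hωs (hsub h2)
  rw [sub_sub_cancel, h1] at h3
  rw [← h3] at h2
  simpa using h2

end

theorem exists_semigroup [CompleteSpace E] (hA : IsHilleYosida A M ω) (hM : 1 ≤ M)
    (hd : IsBiDenselyDefined τ A) (hα : ω < α) (hα0 : 0 < α)
    (hbe : BiEquicontinuous τ (fun i : ℕ × Set.Ici α =>
      ((((i.2 : ℝ) - α : ℝ) : ℂ) ^ i.1) • resolvent A ((i.2 : ℝ) : ℂ) ^ i.1)) :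
    ∃ T : ℝ≥0 → E →L[ℂ] E, IsBiContinuousSemigroup τ T ∧ HasType T M ω ∧ IsBiGenerator τ T A := by
  choose T hlim using fun t : ℝ≥0 => exists_tendsto_eulerApprox hA hM hα hα0 hbe hd t.2
  have hT := isBiContinuousSemigroup_of_tendsto_eulerApprox hA hM hα hα0 hlim hd hbe
  exact ⟨T, hT, hasType_of_tendsto_eulerApprox hA hM hlim,
    isBiGenerator_of_tendsto_eulerApprox hA hM hα hα0 hlim hT hd hbe⟩

end Generation

/-! ### The Euler formula and the space of norm strong continuity -/

section Generator

variable {τ : CoarseTopology E} {A : E →ₗ.[ℂ] E} {M ω α : ℝ} {T : ℝ≥0 → E →L[ℂ] E}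

theorem IsBiContinuousSemigroup.onReal_pow (hT : IsBiContinuousSemigroup τ T) {h : ℝ} (h0 : 0 ≤ h)
    (n : ℕ) : onReal T h ^ n = onReal T (n * h) := by
  induction n with
  | zero =>
    rw [pow_zero, Nat.cast_zero, zero_mul, hT.onReal_zero]
    rfl
  | succ n ih =>
    ext x
    rw [pow_succ, ih, Nat.cast_succ, add_mul, one_mul, hT.onReal_add (by positivity) h0]
    rfl

variable (hT : IsBiContinuousSemigroup τ T)

include hT

theorem IsLaplace.commute {s : ℝ} {Q : E →L[ℂ] E} (hQ : IsLaplace τ T s Q) {t : ℝ}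
    (ht : 0 ≤ t) : Commute (onReal T t) Q := by
  ext x
  refine CoarseTopology.eq_of_forall_functional (τ := τ) fun φ hφ => ?_
  rw [mul_apply_eq_comp, mul_apply_eq_comp, hQ _ (hT.seqContinuous t) φ hφ, hQ.apply hφ]
  refine MeasureTheory.setIntegral_congr_fun measurableSet_Ioi fun r (hr : 0 < r) => ?_
  simp only [← hT.onReal_add ht hr.le, ← hT.onReal_add hr.le ht, add_comm]

variable (h : HasType T M ω) (hA : IsBiGenerator τ T A)

include h hA

theorem IsBiGenerator.commute_eulerStep [CompleteSpace E] {t s : ℝ} (ht : 0 ≤ t) (hs : 0 ≤ s)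
    (hs1 : ω * s < 1) : Commute (onReal T t) (eulerStep A s) := by
  rcases hs.eq_or_lt with rfl | hs
  · rw [eulerStep_zero]
    exact Commute.one_right _
  · rw [eulerStep_of_ne hs.ne']
    exact ((hA.isLaplace_resolvent hT h (by rwa [← one_div, lt_div_iff₀ hs])).2.commute hT
      ht).smul_right _

/-- Here an arbitrary semigroup generated by A is compared directly with the Euler steps, so no
separate uniqueness result is needed. -/
theorem IsBiGenerator.norm_sub_eulerApprox_le [CompleteSpace E] (hM : 1 ≤ M) (hα : ω < α)
    (hα0 : 0 < α) {t : ℝ} (ht : 0 ≤ t) {n : ℕ} (hn0 : 0 < n) (hn : t / n * α ≤ 1 / 2)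
    {x y z : E} (hxy : (x, y) ∈ A.graph) (hyz : (y, z) ∈ A.graph) :
    ‖onReal T t x - eulerApprox A t n x‖ ≤
      2 * (M * Real.exp (2 * α * t)) ^ 3 * t ^ 2 * ‖z‖ / n := by
  have hHY := hA.isHilleYosida hT h
  set K := M * Real.exp (2 * α * t) with hK
  have hK0 : 0 ≤ K := by positivity
  have hn' : (0 : ℝ) < n := by exact_mod_cast hn0
  set δ : ℝ := t / n with hδ
  have hδ0 : 0 ≤ δ := by positivity
  have hω := mul_lt_one_of_mul_le hα hδ0 hn
  have hle (i : ℕ) (hi : i ≤ n) : i * δ ≤ t :=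
    le_trans (by gcongr) (nat_mul_div_le ht n)
  have hTb (r : ℝ) (hr0 : 0 ≤ r) (hr : r ≤ t) (w : E) : ‖onReal T r w‖ ≤ K * ‖w‖ := by
    refine (h.norm_onReal_le hr0 w).trans ?_
    rw [hK]
    gcongr
    nlinarith
  have hJb (i : ℕ) (hi : i ≤ n) (w : E) : ‖(eulerStep A δ ^ i) w‖ ≤ K * ‖w‖ :=
    hHY.norm_eulerStep_pow_apply_le hM hα hα0 hδ0 hn (hle i hi) w
  have hmixed := norm_pow_sub_pow_le (hA.commute_eulerStep hT h hδ0 hδ0 hω) (n := n) (K := K * K)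
    (fun i j hi hj w => by
      rw [hT.onReal_pow hδ0, mul_assoc]
      refine (hTb _ (by positivity) (hle i hi) _).trans ?_
      exact mul_le_mul_of_nonneg_left (hJb j hj w) hK0) x
  have hδt : δ ≤ t := by simpa using hle 1 hn0
  have hP : ‖onReal T δ x - x - (δ : ℂ) • y‖ ≤ K * ‖z‖ * δ ^ 2 := by
    have h1 := ((hA.mem_graph_iff hT).1 hxy).norm_sub_sub_le hT hδ0 (c := K * ‖z‖ * δ)
      fun r hr hrδ => by
        have h2 := ((hA.mem_graph_iff hT).1 hyz).norm_sub_le hr.le (c := K * ‖z‖)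
          fun q hq hqr => hTb q hq.le (hqr.trans (hrδ.trans hδt)) z
        exact h2.trans (by gcongr)
    exact h1.trans (le_of_eq (by ring))
  have hQ := hHY.norm_eulerStep_pow_sub_sub_le hδ0 hω hxy hyz (N := 1) (K := K * ‖z‖)
    fun j hj => hJb j (hj.trans hn0) z
  simp only [Nat.cast_one, one_mul, pow_one] at hQ
  have hPQ : ‖onReal T δ x - eulerStep A δ x‖ ≤ 2 * (K * ‖z‖ * δ ^ 2) := by
    have e : onReal T δ x - eulerStep A δ x =
      (onReal T δ x - x - (δ : ℂ) • y) - (eulerStep A δ x - x - (δ : ℂ) • y) := by abel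
    rw [e, two_mul]
    exact norm_sub_le_of_le hP hQ
  rw [hT.onReal_pow hδ0, hδ, mul_div_cancel₀ _ hn'.ne'] at hmixed
  calc ‖onReal T t x - eulerApprox A t n x‖
      ≤ n * (K * K * (2 * (K * ‖z‖ * δ ^ 2))) := hmixed.trans (by gcongr)
    _ = _ := by
      rw [hδ]
      field_simp

theorem IsBiGenerator.tendsto_eulerApprox [CompleteSpace E] (hM : 1 ≤ M) (x : E) (t : ℝ≥0) :
    Tendsto (fun n => eulerApprox A t n x) atTop (τ.nhds (T t x)) := by
  have hHY := hA.isHilleYosida hT h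
  -- The stability bounds need α positive as well as larger than ω.
  have hα : ω < max ω 0 + 1 := (le_max_left _ _).trans_lt (lt_add_one _)
  have hα0 : 0 < max ω 0 + 1 := (le_max_right _ _).trans_lt (lt_add_one _)
  have hbe := hA.biEquicontinuous_resolvent hT h hα
  obtain ⟨u, v, w, huv, hvw, ⟨C, hC⟩, hu⟩ :=
    exists_seq_mem_sq hHY hM hα hα0 (hA.isBiDenselyDefined hT) x
  rw [← onReal_coe (T := T) t]
  refine CoarseTopology.tendsto_of_approx (u := u)
    ((hT.seqContinuous t).tendsto (.of_forall hC) hu) (fun p hp ε hε => ?_) fun k => ?_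
  · exact eventually_eventually_seminorm_eulerApprox_lt hα0 hbe t.2
      ⟨C + ‖x‖, fun n => norm_sub_le_of_le (hC n) le_rfl⟩ (CoarseTopology.tendsto_sub_iff.2 hu) hp hε
  · refine CoarseTopology.tendsto_of_tendsto_norm (tendsto_iff_norm_sub_tendsto_zero.2 ?_)
    refine squeeze_zero' (.of_forall fun _ => norm_nonneg _) ?_
      (tendsto_const_div_atTop_nhds_zero_nat
        (2 * (M * Real.exp (2 * (max ω 0 + 1) * t)) ^ 3 * t ^ 2 * ‖w k‖))
    filter_upwards [eventually_div_mul_le t (max ω 0 + 1)] with n hn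
    rw [norm_sub_rev]
    exact hA.norm_sub_eulerApprox_le hT h hM hα hα0 t.2 hn.1 hn.2 (huv k) (hvw k)

/-- Orbits from D(A) are Lipschitz near 0 by the integrated relation; boundedness on [0, 1] extends
continuity at 0 to the norm closure. -/
theorem IsBiGenerator.tendsto_of_mem_domainClosure {x : E} (hx : x ∈ domainClosure A) :
    Tendsto (fun t => T t x) (𝓝 0) (𝓝 x) := by
  have hM := h.nonneg
  set K := M * Real.exp (|ω| * 1) with hK
  have hK0 : 0 ≤ K := by positivity
  have hb (d : ℝ≥0) (hd : d ≤ 1) (w : E) : ‖T d w‖ ≤ K * ‖w‖ := by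
    rw [← onReal_coe (T := T)]
    exact h.norm_onReal_le_of_le d.2 (by exact_mod_cast hd) w
  rw [Metric.tendsto_nhds]
  intro ε hε
  obtain ⟨y, hy, hxy⟩ := Metric.mem_closure_iff.1 (show x ∈ closure (A.domain : Set E) from hx)
    (ε / (2 * (K + 1))) (by positivity)
  have hz := (hA.mem_graph_iff hT).1 (A.mem_graph ⟨y, hy⟩)
  set z := A ⟨y, hy⟩
  have h0 : Tendsto (fun d : ℝ≥0 => K * ‖z‖ * d) (𝓝 0) (𝓝 0) :=
    Continuous.tendsto' (by fun_prop) _ _ (by simp)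
  filter_upwards [h0.eventually_lt_const (half_pos hε), eventually_le_nhds (zero_lt_one (α := ℝ≥0))]
    with d hd hd1
  have h1 : ‖T d y - y‖ ≤ K * ‖z‖ * d := by
    rw [← onReal_coe (T := T)]
    refine hz.norm_sub_le d.2 fun r hr hrd => ?_
    exact h.norm_onReal_le_of_le hr.le (hrd.trans (by exact_mod_cast hd1)) z
  rw [dist_eq_norm] at hxy ⊢
  have e : T d x - x = T d (x - y) + (T d y - y) - (x - y) := by
    rw [map_sub]
    abel
  have h2 : (K + 1) * ‖x - y‖ < ε / 2 := by
    rw [lt_div_iff₀ (by positivity)] at hxy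
    linarith
  have h3 := norm_sub_le_of_le (norm_add_le_of_le (hb d hd1 (x - y)) h1) (le_refl ‖x - y‖)
  rw [e]
  linarith

/-- For the converse, time averages of a norm-continuous orbit lie in D(A) and converge to x in
norm. -/
theorem IsBiGenerator.mem_domainClosure_iff [CompleteSpace E] {x : E} :
    x ∈ domainClosure A ↔ Continuous fun t : ℝ≥0 => T t x := by
  refine ⟨fun hx => continuous_orbit hT.map_add h (hA.tendsto_of_mem_domainClosure hT h hx),
    fun hx => ?_⟩
  change x ∈ closure (A.domain : Set E)
  rw [Metric.mem_closure_iff]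
  intro ε hε
  have h1 : Tendsto (fun t : ℝ≥0 => T t x) (𝓝 0) (𝓝 x) := by
    simpa [hT.map_zero] using hx.tendsto 0
  obtain ⟨δ, hδ, hb⟩ := Metric.eventually_nhds_iff.1
    ((tendsto_iff_norm_sub_tendsto_zero.1 h1).eventually_lt_const (half_pos hε))
  obtain ⟨y, hy, hyx, -⟩ := hA.exists_mem_domain hT x (half_pos hδ)
  refine ⟨y, hy, ?_⟩
  rw [dist_eq_norm, norm_sub_rev]
  refine (hyx (ε / 2) fun r hr hrδ => (hb ?_).le).trans_lt (half_lt_self hε)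
  rw [NNReal.dist_eq, Real.coe_toNNReal _ hr.le, NNReal.coe_zero, sub_zero, abs_of_pos hr]
  linarith

/-- Norm continuity of the orbit of y upgrades the τ-limit of the mean of T(r)y to a norm limit.
Conversely, norm convergence bounds the quotients only for t < δ; for δ ≤ t ≤ 1 the factor 1/t is at
most 1/δ. -/
theorem IsBiGenerator.mem_graph_iff_tendsto_norm {x y : E} (hy : y ∈ domainClosure A) :
    (x, y) ∈ A.graph ↔
      Tendsto (fun t : ℝ≥0 => (t : ℝ)⁻¹ • (T t x - x)) (𝓝[>] 0) (𝓝 y) := by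
  refine ⟨fun hxy => ?_, fun hxy => (hA x y).2 ⟨CoarseTopology.tendsto_of_tendsto_norm hxy, ?_⟩⟩
  · have hI := (hA.mem_graph_iff hT).1 hxy
    rw [Metric.tendsto_nhds]
    intro ε hε
    obtain ⟨δ, hδ, hb⟩ := Metric.eventually_nhds_iff.1 ((tendsto_iff_norm_sub_tendsto_zero.1
      (hA.tendsto_of_mem_domainClosure hT h hy)).eventually_lt_const (half_pos hε))
    have hev : ∀ᶠ t : ℝ≥0 in 𝓝[>] 0, (t : ℝ) < δ :=
      (NNReal.continuous_coe.tendsto' 0 0 rfl).mono_left nhdsWithin_le_nhds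
        |>.eventually_lt_const hδ
    filter_upwards [hev, self_mem_nhdsWithin] with t htδ (ht : 0 < t)
    have ht' : (0 : ℝ) < t := ht
    have h2 := hI.norm_sub_sub_le hT ht'.le (c := ε / 2) fun r hr hrt => (hb (by
      rw [NNReal.dist_eq, Real.coe_toNNReal _ hr.le, NNReal.coe_zero, sub_zero, abs_of_pos hr]
      linarith)).le
    have h3 : (t : ℝ)⁻¹ • (T t x - x) - y
        = (t : ℝ)⁻¹ • (onReal T t x - x - ((t : ℝ) : ℂ) • y) := by
      rw [Complex.coe_smul, smul_sub _ _ ((t : ℝ) • y), smul_smul, inv_mul_cancel₀ ht'.ne',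
        one_smul, onReal_coe]
    rw [dist_eq_norm, h3, norm_smul, norm_inv, Real.norm_of_nonneg ht'.le, inv_mul_lt_iff₀ ht']
    nlinarith
  · have hM := h.nonneg
    obtain ⟨δ, hδ, hb⟩ := Metric.eventually_nhds_iff.1
      (eventually_nhdsWithin_iff.1 (hxy.norm.eventually_lt_const (lt_add_one ‖y‖)))
    refine ⟨max (‖y‖ + 1) (δ⁻¹ * (M * Real.exp (|ω| * 1) * ‖x‖ + ‖x‖)), fun t ht ht1 => ?_⟩
    have ht' : (0 : ℝ) < t := ht
    rcases lt_or_ge (t : ℝ) δ with htδ | htδ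
    · refine le_max_of_le_left (hb ?_ ht).le
      rwa [NNReal.dist_eq, NNReal.coe_zero, sub_zero, abs_of_pos ht']
    · refine le_max_of_le_right ?_
      rw [norm_smul, norm_inv, Real.norm_of_nonneg ht'.le, ← onReal_coe (T := T)]
      gcongr
      exact norm_sub_le_of_le
        (h.norm_onReal_le_of_le t.2 (by exact_mod_cast ht1) x) le_rfl

end Generator

end BiCont

end

/-! ### Assembly of the theorem. -/

theorem mainTheorem1 {E : Type*} [NormedAddCommGroup E] [NormedSpace ℂ E] [CompleteSpace E]
    (τ : BiCont.CoarseTopology E) (A : E →ₗ.[ℂ] E) (M ω : ℝ) (hM : 1 ≤ M) :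
    ((∃ T : ℝ≥0 → E →L[ℂ] E, BiCont.IsBiContinuousSemigroup τ T ∧ BiCont.HasType T M ω ∧
        BiCont.IsBiGenerator τ T A) ↔
      (BiCont.IsHilleYosida A M ω ∧ BiCont.IsBiDenselyDefined τ A ∧
        ∀ α : ℝ, ω < α → BiCont.BiEquicontinuous τ (fun i : ℕ × Set.Ici α =>
          (((((i.2 : ℝ) - α : ℝ) : ℂ)) ^ i.1) • BiCont.resolvent A ((i.2 : ℝ) : ℂ) ^ i.1))) ∧
    ∀ T : ℝ≥0 → E →L[ℂ] E, BiCont.IsBiContinuousSemigroup τ T → BiCont.HasType T M ω →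
      BiCont.IsBiGenerator τ T A →
        (∀ (x : E) (t : ℝ≥0), 0 < t →
          Tendsto (fun m : ℕ => ((((m / t : ℝ) : ℂ) •
            BiCont.resolvent A ((m / t : ℝ) : ℂ)) ^ m) x) atTop (τ.nhds (T t x))) ∧
        (BiCont.domainClosure A : Set E) = {x : E | Continuous (fun t : ℝ≥0 => T t x)} ∧
        ∃ hinv : ∀ t : ℝ≥0, Set.MapsTo (T t) (BiCont.domainClosure A) (BiCont.domainClosure A),
          BiCont.IsC0Semigroup (fun t => (T t).restrict (hinv t)) ∧
          BiCont.IsC0Generator (fun t => (T t).restrict (hinv t))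
            (BiCont.part A (BiCont.domainClosure A)) := by
  refine ⟨⟨?_, ?_⟩, fun T hT h hA => ⟨fun x t ht => ?_, ?_, ?_⟩⟩
  · rintro ⟨T, hT, h, hA⟩
    exact ⟨hA.isHilleYosida hT h, hA.isBiDenselyDefined hT,
      fun α hα => hA.biEquicontinuous_resolvent hT h hα⟩
  · rintro ⟨hA, hd, hbe⟩
    have hα : ω < max ω 0 + 1 := (le_max_left _ _).trans_lt (lt_add_one _)
    have hα0 : 0 < max ω 0 + 1 := (le_max_right _ _).trans_lt (lt_add_one _)
    exact BiCont.exists_semigroup hA hM hd hα hα0 (hbe _ hα)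
  · refine (hA.tendsto_eulerApprox hT h hM x t).congr' ?_
    filter_upwards [eventually_gt_atTop 0] with m hm
    have hm' : (0 : ℝ) < m := by exact_mod_cast hm
    have ht' : (0 : ℝ) < t := ht
    rw [BiCont.eulerApprox, BiCont.eulerStep_of_ne (by positivity), inv_div]
  · ext x
    exact hA.mem_domainClosure_iff hT h
  · have hcont (x : BiCont.domainClosure A) : Continuous fun t : ℝ≥0 => T t x :=
      (hA.mem_domainClosure_iff hT h).1 x.2
    refine ⟨fun t x hx => ?_, ⟨?_, fun s t => ?_, fun x => ?_⟩, fun x y => ?_⟩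
    · refine (hA.mem_domainClosure_iff hT h).2 ?_
      -- The orbit of T(t)x is a time shift of the orbit of x, so norm continuity, and with it the
      -- closure of D(A), is preserved.
      have h1 : (fun s => T s (T t x)) = fun s => T (s + t) x := by
        ext s
        rw [hT.map_add]
        rfl
      rw [h1]
      exact ((hA.mem_domainClosure_iff hT h).1 hx).comp (continuous_add_const t)
    · ext x
      simp [hT.map_zero]
    · ext x
      simp [hT.map_add]
    · exact (hcont x).subtype_mk _
    -- Here `y` already lies in the closure of D(A), so the graph of the part is that of A, and
    -- limits in the subspace are limits in E.
    · rw [BiCont.mem_graph_part, hA.mem_graph_iff_tendsto_norm hT h y.2,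
        Topology.IsEmbedding.subtypeVal.tendsto_nhds_iff]
      rfl
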